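/- Let $G$ be a finite directed graph (self-loops allowed) with $n\ge 1$ vertices and let $F$ be a set of "forbidden" vertices. A matching $M$ is a set of edges no two of which have a common source or a common destination. A vertex is unmatched if it is not the destination of an edge of $M$; $M$ is allowed if no vertex of $F$ is unmatched. A strongly connected component of $G$ is a source component if no edge enters it from outside. The cost of $M$ is the number of unmatched vertices plus the number of source components without an unmatched vertex. For a matching $M$, the flow graph $G_{\rm flow}(M)$ is the directed graph with nodes $u_{\rm src},u_{\rm dst}$ for every vertex $u$ of $G$, nodes $s,t$, a node $s_X$ for every source component $X$ without an unmatched vertex, and nodes $n^{S}_1,\dots,n^{S}_{k-1}$ for every source component $S$ with $k\ge 1$ unmatched vertices. Its edges are: - $u_{\rm src}\to v_{\rm dst}$ for every edge $(u,v)\notin M$ of $G$, and $v_{\rm dst}\to u_{\rm src}$ for every $(u,v)\in M$; - $a_{\rm dst}\to b_{\rm dst}$ whenever $a$ is the only unmatched vertex of a source component $Y$ and $b\in Y\setminus F$; - $s\to u_{\rm src}$ for every $u$ that is not the source of an edge of $M$; - $s\to s_X$ and $s_X\to b_{\rm dst}$ for every source component $X$ without an unmatched vertex and every $b\in X\setminus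 F$; - $a_{\rm dst}\to t$ for every unmatched $a$ that lies in no source component; - $a_{\rm dst}\to n^{S}_j$ and $n^{S}_j\to t$ for every source component $S$, every unmatched $a\in S$ and every $j$. The augmentation of $M$ on a path $p$ in $G_{\rm flow}(M)$ removes from $M$ every $(u,v)$ such that $p$ uses the edge $v_{\rm dst}\to u_{\rm src}$ and adds every $(u,v)$ such that $p$ uses the edge $u_{\rm src}\to v_{\rm dst}$. The augmentation algorithm starts from an allowed matching $M_0$. In each iteration it takes any maximal collection $\mathcal P$ of shortest paths from $s$ to $t$ in $G_{\rm flow}(M)$, any two of which have only $s$ and $t$ in common; if $\mathcal P$ is empty (there is no path from $s$ to $t$), it terminates; otherwise it replaces $M$ by the result of augmenting $M$ sequentially, in any order, on the paths of $\mathcal P$. **Theorem.** For every allowed matching $M_0$ and every choice of the collections $\mathcal P$ and of the orders, all matchings $M$ produced by the algorithm are allowed; the algorithm terminates after at most $6\sqrt n$ iterations (the last one, which finds $\mathcal P$ empty, included); and at termination $M$ is an allowed matching of minimum cost among all allowed matchings. -/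

import Mathlib

namespace MinCostMatching

/-! ### Matchings in a directed graph and their cost -/

section Matchings

variable {V : Type*}

/-- A matching in a directed graph: a set of edges, no two of which have a common source or a
common destination. -/
structure IsMatching (G : Digraph V) (M : Set (V × V)) : Prop where
  adj : ∀ e ∈ M, G.Adj e.1 e.2
  source_inj : ∀ e ∈ M, ∀ f ∈ M, e.1 = f.1 → e = f
  dest_inj : ∀ e ∈ M, ∀ f ∈ M, e.2 = f.2 → e = f

/-- The set `U(M)` of unmatched vertices: those that are not the destination of an edge of `M`. -/
def unmatched (M : Set (V × V)) : Set V :=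
  {v | ∀ u, (u, v) ∉ M}

/-- An allowed matching with respect to the set `F` of forbidden vertices: no vertex of `F` is
unmatched. -/
def IsAllowedMatching (G : Digraph V) (F : Set V) (M : Set (V × V)) : Prop :=
  IsMatching G M ∧ unmatched M ∩ F = ∅

/-- There is a directed path (possibly of length zero) from `u` to `v`. -/
def Reachable (G : Digraph V) (u v : V) : Prop :=
  Relation.ReflTransGen G.Adj u v

/-- `S` is (the vertex set of) a strongly connected component of `G`. -/
def IsStrongComponent (G : Digraph V) (S : Set V) : Prop :=
  ∃ v, S = {w | Reachable G v w ∧ Reachable G w v}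

/-- `S` is a source strongly connected component: in the condensation of `G` it has no incoming
edge, that is, no edge of `G` enters `S` from outside. -/
def IsSourceComponent (G : Digraph V) (S : Set V) : Prop :=
  IsStrongComponent G S ∧ ∀ u v, G.Adj u v → v ∈ S → u ∈ S

/-- The cost of a matching: the number of unmatched vertices plus the number of source strongly
connected components without an unmatched vertex. -/
noncomputable def cost (G : Digraph V) (M : Set (V × V)) : ℕ :=
  (unmatched M).ncard + {S : Set V | IsSourceComponent G S ∧ S ∩ unmatched M = ∅}.ncard

/-- `M` is an allowed matching whose cost is minimum among all allowed matchings. -/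
def IsMinCostAllowedMatching (G : Digraph V) (F : Set V) (M : Set (V × V)) : Prop :=
  IsAllowedMatching G F M ∧ ∀ M', IsAllowedMatching G F M' → cost G M ≤ cost G M'

end Matchings

/-! ### Maximal vertex-disjoint collections of shortest paths -/

section Paths

variable {W : Type*}

/-- `p` is the list of vertices of a (simple) directed path from `a` to `b` in `H`. -/
structure IsPath (H : Digraph W) (a b : W) (p : List W) : Prop where
  head : p.head? = some a
  last : p.getLast? = some b
  chain : p.IsChain H.Adj
  nodup : p.Nodup

/-- `p` is a shortest path from `a` to `b` in `H`. -/
def IsShortestPath (H : Digraph W) (a b : W) (p : List W) : Prop :=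
  IsPath H a b p ∧ ∀ q, IsPath H a b q → p.length ≤ q.length

/-- Any two (distinct) paths of the collection have only the vertices `a` and `b` in common. -/
def VertexDisjoint (a b : W) (P : Set (List W)) : Prop :=
  ∀ p ∈ P, ∀ q ∈ P, p ≠ q → ∀ x, x ∈ p → x ∈ q → x = a ∨ x = b

/-- `P` is a maximal vertex-disjoint collection of shortest paths from `a` to `b`: its members are
shortest paths, they are vertex-disjoint, and no further path can be added to it. -/
structure IsMaximalDisjointShortestPaths (H : Digraph W) (a b : W) (P : Set (List W)) : Prop where
  shortest : ∀ p ∈ P, IsShortestPath H a b p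
  disjoint : VertexDisjoint a b P
  maximal : ∀ q ∉ P, IsShortestPath H a b q → ¬ VertexDisjoint a b (insert q P)

end Paths

/-! ### The flow graph -/

section Flow

/-- The vertices of the splitting of a directed graph: a source node and a destination node for
every vertex. -/
inductive SplitVertex (V : Type*) where
  | src (v : V) : SplitVertex V
  | dst (v : V) : SplitVertex V

/-- The possible vertices of the flow graphs: the nodes of the splitting, the terminals `s` and
`t`, a node `comp S` (the node `s_i`, for `S = X_i`) and nodes `extra S j` (the nodes `n^{(i)}_j`
for `S = S_i`, numbered from `j = 0`). For a given matching only some of the nodes `comp S` and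
`extra S j` are used; the others have no incident edges in the flow graph. -/
inductive FlowVertex (V : Type*) where
  | core (x : SplitVertex V) : FlowVertex V
  | s : FlowVertex V
  | t : FlowVertex V
  | comp (S : Set V) : FlowVertex V
  | extra (S : Set V) (j : ℕ) : FlowVertex V

variable {V : Type*}

/-- The source node of `v` in the flow graph. -/
abbrev FlowVertex.src (v : V) : FlowVertex V := .core (.src v)

/-- The destination node of `v` in the flow graph. -/
abbrev FlowVertex.dst (v : V) : FlowVertex V := .core (.dst v)

/-- The edges of the matched splitting `G_s(M)`. -/
inductive MatchedSplittingAdj (G : Digraph V) (F : Set V) (M : Set (V × V)) :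
    SplitVertex V → SplitVertex V → Prop
  /-- The edges of the splitting that are not in the twin matching of `M`. -/
  | forward (u v : V) : G.Adj u v → (u, v) ∉ M →
      MatchedSplittingAdj G F M (.src u) (.dst v)
  /-- The edges of the twin matching of `M`, with reversed orientation. -/
  | backward (u v : V) : G.Adj u v → (u, v) ∈ M →
      MatchedSplittingAdj G F M (.dst v) (.src u)
  /-- If `a` is the only unmatched vertex of the source component `Y`: the edges from the
  destination node of `a` to those of the vertices of `Y` outside `F`. -/
  | shift (Y : Set V) (a b : V) : IsSourceComponent G Y → Y ∩ unmatched M = {a} →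
      b ∈ Y → b ∉ F → MatchedSplittingAdj G F M (.dst a) (.dst b)

/-- The matched splitting `G_s(M)`. -/
def matchedSplitting (G : Digraph V) (F : Set V) (M : Set (V × V)) : Digraph (SplitVertex V) where
  Adj := MatchedSplittingAdj G F M

/-- The edges of the flow graph `G_flow(M)`. -/
inductive FlowAdj (G : Digraph V) (F : Set V) (M : Set (V × V)) :
    FlowVertex V → FlowVertex V → Prop
  /-- The edges of the matched splitting. -/
  | split (x y : SplitVertex V) : (matchedSplitting G F M).Adj x y →
      FlowAdj G F M (.core x) (.core y)
  /-- From `s` to the source nodes without an outgoing edge in the twin matching of `M`. -/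
  | source (u : V) : (∀ v, (u, v) ∉ M) → FlowAdj G F M .s (.src u)
  /-- From `s` to the node of every source component `X` without an unmatched vertex. -/
  | toComp (X : Set V) : IsSourceComponent G X → X ∩ unmatched M = ∅ →
      FlowAdj G F M .s (.comp X)
  /-- From the node of such a component `X` to the destination nodes of its vertices outside
  `F`. -/
  | fromComp (X : Set V) (b : V) : IsSourceComponent G X → X ∩ unmatched M = ∅ →
      b ∈ X → b ∉ F → FlowAdj G F M (.comp X) (.dst b)
  /-- From the unmatched destination nodes outside the source components to `t`. -/
  | sink (a : V) : a ∈ unmatched M → (∀ S, IsSourceComponent G S → a ∉ S) →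
      FlowAdj G F M (.dst a) .t
  /-- If the source component `S` has `k` unmatched vertices, it has `k - 1` extra nodes; there is
  an edge from each of its unmatched destination nodes to each of its extra nodes. -/
  | toExtra (S : Set V) (a : V) (j : ℕ) : IsSourceComponent G S → a ∈ S ∩ unmatched M →
      j + 1 < (S ∩ unmatched M).ncard → FlowAdj G F M (.dst a) (.extra S j)
  /-- From each extra node to `t`. -/
  | fromExtra (S : Set V) (j : ℕ) : IsSourceComponent G S →
      j + 1 < (S ∩ unmatched M).ncard → FlowAdj G F M (.extra S j) .t

/-- The flow graph `G_flow(M)`. -/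
def flowGraph (G : Digraph V) (F : Set V) (M : Set (V × V)) : Digraph (FlowVertex V) where
  Adj := FlowAdj G F M

/-! ### The augmentation algorithm -/

/-- The augmentation of `M` on the path `p` of a flow graph: the edges `(u, v)` of `M` for which
`p` goes from the destination node of `v` to the source node of `u` are removed, and the edges
`(u, v)` for which `p` goes from the source node of `u` to the destination node of `v` are
added. (`[x, y] <:+: p` says that `x` and `y` are consecutive in `p`.) -/
def augment (M : Set (V × V)) (p : List (FlowVertex V)) : Set (V × V) :=
  {e | e ∈ M ∧ ¬ [FlowVertex.dst e.2, FlowVertex.src e.1] <:+: p} ∪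
    {e | [FlowVertex.src e.1, FlowVertex.dst e.2] <:+: p}

/-- The algorithm stops at `M`: the flow graph of `M` has no path from `s` to `t`. -/
def Terminates (G : Digraph V) (F : Set V) (M : Set (V × V)) : Prop :=
  ¬ ∃ p, IsPath (flowGraph G F M) .s .t p

/-- One augmenting iteration of the algorithm can replace `M` by `M'`: for some nonempty maximal
collection of vertex-disjoint shortest paths from `s` to `t` in the flow graph of `M`, listed in an
arbitrary order, `M'` is the result of augmenting `M` sequentially on the paths of the list. -/
def Iteration (G : Digraph V) (F : Set V) (M M' : Set (V × V)) : Prop :=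
  ∃ P : List (List (FlowVertex V)), P ≠ [] ∧ P.Nodup ∧
    IsMaximalDisjointShortestPaths (flowGraph G F M) .s .t {p | p ∈ P} ∧
    M' = P.foldl augment M

/-- `M 0, …, M K` is a (possibly unfinished) execution of the algorithm, started at `M₀`, in which
`K` augmentations have been made. -/
def IsRun (G : Digraph V) (F : Set V) (M₀ : Set (V × V)) (K : ℕ) (M : ℕ → Set (V × V)) : Prop :=
  M 0 = M₀ ∧ ∀ i < K, Iteration G F (M i) (M (i + 1))

end Flow

end MinCostMatching

/-! By `IsMatching.cost_add`, lowering the cost is the same as raising `|M|` plus the number of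
source components that contain an unmatched vertex. This sum is the size of `extendedMatching`, a
bipartite matching in which each source component is an additional left vertex, assigned to one of
its unmatched vertices. The flow graph acts as a residual graph for this problem, and the proof
adapts the analysis of Hopcroft and Karp.

Augmentation. The paths of one iteration form a unit flow `E`, and augmenting on them in any order
is one simultaneous change, `augmentEdges M E`. It keeps matched sources matched and keeps a source
component with unmatched vertices from losing them all: its `k` unmatched vertices have only `k - 1`
extra nodes through which to leave. The first edge of any path adds a matched source or a newly hit
component, so the cost drops.

Distance. Along `E` the distance from `s` rises by one per edge, and every edge created by the
augmentation should fail to go up. This can break for the shift edges that appear when a component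
drops to one unmatched vertex; truncating the distance (`level`) repairs it. A new path as short as
the old ones would then use old edges only and avoid `E`, apart from extra nodes, which are
interchangeable; this contradicts maximality (`lt_length_of_isPath_augmentEdges`).

Cuts. If a set containing `s` but not `t` is left only through nodes of `C`, no allowed matching
beats `M` by more than `|C|` (`cost_le_of_cut`). The nodes reachable from `s` give `C = ∅` and
optimality at termination. At distance at least `D + 2`, the levels `1, …, D` are disjoint cuts
among at most `3n` nodes, so `D` times the remaining improvement is at most `3n`. After half of the
augmentations, both factors are about `K / 2`, whence `K = O(√n)`. -/

namespace MinCostMatching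

/-! ### Consecutive pairs of a list and paths -/

section Lists

variable {W : Type*}

theorem pair_infix_iff {p : List W} {x y : W} :
    [x, y] <:+: p ↔ ∃ i, p[i]? = some x ∧ p[i + 1]? = some y := by
  rw [List.infix_iff_getElem?]
  constructor
  · rintro ⟨k, -, h⟩
    refine ⟨k, by simpa using h 0 (by simp), ?_⟩
    have := h 1 (by simp)
    rwa [Nat.add_comm] at this
  · rintro ⟨i, h1, h2⟩
    refine ⟨i, ?_, ?_⟩
    · have := (List.getElem?_eq_some_iff.1 h2).1
      simp only [List.length_cons, List.length_nil]
      omega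
    · intro j hj
      have : j = 0 ∨ j = 1 := by simp at hj; omega
      rcases this with rfl | rfl
      · simpa using h1
      · rw [Nat.add_comm]; simpa using h2

theorem isChain_iff_pair_infix {R : W → W → Prop} {p : List W} :
    p.IsChain R ↔ ∀ x y, [x, y] <:+: p → R x y := by
  simp only [pair_infix_iff, List.isChain_iff_getElem]
  constructor
  · rintro h x y ⟨i, h1, h2⟩
    obtain ⟨_, rfl⟩ := List.getElem?_eq_some_iff.1 h1
    obtain ⟨hi, rfl⟩ := List.getElem?_eq_some_iff.1 h2
    exact h i hi
  · intro h i hi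
    exact h _ _ ⟨i, by simp, by simp [hi]⟩

theorem mem_left_of_pair_infix {p : List W} {x y : W} (h : [x, y] <:+: p) : x ∈ p :=
  h.subset (by simp)

theorem mem_right_of_pair_infix {p : List W} {x y : W} (h : [x, y] <:+: p) : y ∈ p :=
  h.subset (by simp)

theorem getElem?_inj_of_nodup {p : List W} (hp : p.Nodup) {i j : ℕ} {x : W}
    (hi : p[i]? = some x) (hj : p[j]? = some x) : i = j :=
  (List.getElem?_inj (List.getElem?_eq_some_iff.1 hi).1 hp).1 (hi.trans hj.symm)

theorem pair_infix_right_unique {p : List W} (hp : p.Nodup) {x y z : W}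
    (hy : [x, y] <:+: p) (hz : [x, z] <:+: p) : y = z := by
  obtain ⟨i, h1, h2⟩ := pair_infix_iff.1 hy
  obtain ⟨j, h3, h4⟩ := pair_infix_iff.1 hz
  obtain rfl := getElem?_inj_of_nodup hp h1 h3
  exact Option.some.inj (h2.symm.trans h4)

theorem pair_infix_left_unique {p : List W} (hp : p.Nodup) {x y z : W}
    (hx : [x, z] <:+: p) (hy : [y, z] <:+: p) : x = y := by
  obtain ⟨i, h1, h2⟩ := pair_infix_iff.1 hx
  obtain ⟨j, h3, h4⟩ := pair_infix_iff.1 hy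
  have := getElem?_inj_of_nodup hp h2 h4
  obtain rfl : i = j := by omega
  exact Option.some.inj (h1.symm.trans h3)

theorem ne_of_pair_infix {p : List W} (hp : p.Nodup) {x y : W} (h : [x, y] <:+: p) : x ≠ y := by
  rintro rfl
  obtain ⟨i, h1, h2⟩ := pair_infix_iff.1 h
  have := getElem?_inj_of_nodup hp h1 h2
  omega

/-- A function that increases by at most one along every edge of a walk. -/
theorem potential_le_add {p : List W} {φ : W → ℕ}
    (h : ∀ x y, [x, y] <:+: p → φ y ≤ φ x + 1) {i k : ℕ} {x y : W}
    (hx : p[i]? = some x) (hy : p[i + k]? = some y) : φ y ≤ φ x + k := by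
  induction k generalizing y with
  | zero => simp only [Nat.add_zero] at hy; simp [Option.some.inj (hx.symm.trans hy)]
  | succ k ih =>
    have hk := (List.getElem?_eq_some_iff.1 hy).1
    have hz : p[i + k]? = some p[i + k] := by simp
    have := ih hz
    have := h _ _ (pair_infix_iff.2 ⟨i + k, hz, hy⟩)
    omega

theorem potential_add_one_le_length {p : List W} {φ : W → ℕ} {a b : W}
    (h : ∀ x y, [x, y] <:+: p → φ y ≤ φ x + 1) (ha : p.head? = some a)
    (hb : p.getLast? = some b) (h0 : φ a = 0) : φ b + 1 ≤ p.length := by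
  rw [List.head?_eq_getElem?] at ha
  rw [List.getLast?_eq_getElem?] at hb
  have := potential_le_add h ha (k := p.length - 1) (by simpa using hb)
  have := (List.getElem?_eq_some_iff.1 ha).1
  omega

/-- The walk has no more steps than are needed to raise `φ` from `0` to `φ b`, so the bounds counted
from its two ends meet at every position. -/
theorem potential_eq_index {p : List W} {φ : W → ℕ} {a b : W}
    (h : ∀ x y, [x, y] <:+: p → φ y ≤ φ x + 1) (ha : p.head? = some a)
    (hb : p.getLast? = some b) (h0 : φ a = 0) (hl : p.length ≤ φ b + 1) {i : ℕ} {x : W}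
    (hx : p[i]? = some x) : φ x = i := by
  rw [List.head?_eq_getElem?] at ha
  rw [List.getLast?_eq_getElem?] at hb
  have hi := (List.getElem?_eq_some_iff.1 hx).1
  have h1 := potential_le_add h ha (k := i) (by simpa using hx)
  have h2 := potential_le_add h hx (k := p.length - 1 - i) (y := b) (by rw [← hb]; congr 1; omega)
  omega

theorem potential_tight {p : List W} {φ : W → ℕ} {a b : W}
    (h : ∀ x y, [x, y] <:+: p → φ y ≤ φ x + 1) (ha : p.head? = some a)
    (hb : p.getLast? = some b) (h0 : φ a = 0) (hl : p.length ≤ φ b + 1) {x y : W}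
    (hxy : [x, y] <:+: p) : φ y = φ x + 1 := by
  obtain ⟨i, h1, h2⟩ := pair_infix_iff.1 hxy
  rw [potential_eq_index h ha hb h0 hl h1, potential_eq_index h ha hb h0 hl h2]

theorem nodup_of_potential {p : List W} {φ : W → ℕ} {a b : W}
    (h : ∀ x y, [x, y] <:+: p → φ y ≤ φ x + 1) (ha : p.head? = some a)
    (hb : p.getLast? = some b) (h0 : φ a = 0) (hl : p.length ≤ φ b + 1) : p.Nodup := by
  rw [List.nodup_iff_getElem?_ne_getElem?]
  intro i j hij hj he
  have hx : p[i]? = some p[i] := by simp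
  have h1 := potential_eq_index h ha hb h0 hl hx
  have h2 := potential_eq_index h ha hb h0 hl (he.symm.trans hx)
  omega

variable {H : Digraph W} {a b : W} {p : List W}

theorem IsPath.adj (hp : IsPath H a b p) {x y : W} (h : [x, y] <:+: p) : H.Adj x y :=
  isChain_iff_pair_infix.1 hp.chain x y h

theorem IsPath.head_mem (hp : IsPath H a b p) : a ∈ p := List.mem_of_head? hp.head

theorem IsPath.last_mem (hp : IsPath H a b p) : b ∈ p := List.mem_of_getLast? hp.last

theorem IsPath.exists_succ (hp : IsPath H a b p) {x : W} (hx : x ∈ p) (hxb : x ≠ b) :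
    ∃ y, [x, y] <:+: p := by
  obtain ⟨i, hi, rfl⟩ := List.getElem_of_mem hx
  have hl := hp.last
  rw [List.getLast?_eq_getElem?] at hl
  have : i + 1 < p.length := by
    by_contra hcon
    apply hxb
    obtain rfl : i = p.length - 1 := by omega
    simpa [hi] using hl
  exact ⟨p[i + 1], pair_infix_iff.2 ⟨i, by simp, by simp [this]⟩⟩

theorem IsPath.exists_pred (hp : IsPath H a b p) {x : W} (hx : x ∈ p) (hxa : x ≠ a) :
    ∃ y, [y, x] <:+: p := by
  obtain ⟨i, hi, rfl⟩ := List.getElem_of_mem hx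
  have hl := hp.head
  rw [List.head?_eq_getElem?] at hl
  obtain _ | i := i
  · exact absurd (by simpa [hi] using hl) hxa
  · exact ⟨p[i], pair_infix_iff.2 ⟨i, by simp, by simp [hi]⟩⟩

theorem IsPath.right_ne (hp : IsPath H a b p) {x y : W} (h : [x, y] <:+: p) : y ≠ a := by
  rintro rfl
  obtain ⟨i, -, h2⟩ := pair_infix_iff.1 h
  have := getElem?_inj_of_nodup hp.nodup h2 (List.head?_eq_getElem?.symm.trans hp.head)
  omega

theorem IsPath.left_ne (hp : IsPath H a b p) {x y : W} (h : [x, y] <:+: p) : x ≠ b := by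
  rintro rfl
  obtain ⟨i, h1, h2⟩ := pair_infix_iff.1 h
  have := getElem?_inj_of_nodup hp.nodup h1 (List.getLast?_eq_getElem?.symm.trans hp.last)
  have := (List.getElem?_eq_some_iff.1 h2).1
  omega

theorem isPath_singleton (H : Digraph W) (a : W) : IsPath H a a [a] :=
  ⟨by simp, by simp, by simp, by simp⟩

/-- A path can be extended by an edge, up to a shortcut. -/
theorem IsPath.exists_extend (hp : IsPath H a b p) {c : W} (hc : H.Adj b c) :
    ∃ q, IsPath H a c q ∧ q.length ≤ p.length + 1 := by
  by_cases hcp : c ∈ p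
  · obtain ⟨l, r, rfl⟩ := List.append_of_mem hcp
    refine ⟨l ++ [c], ⟨?_, by simp, ?_, ?_⟩, by simp⟩
    · have := hp.head
      cases l <;> simpa using this
    · have := hp.chain
      rw [List.append_cons] at this
      exact this.left_of_append
    · have := hp.nodup
      rw [List.append_cons] at this
      exact this.of_append_left
  · refine ⟨p ++ [c], ⟨?_, by simp, ?_, ?_⟩, by simp⟩
    · rw [List.head?_append, hp.head]; rfl
    · rw [List.isChain_append]
      refine ⟨hp.chain, by simp, ?_⟩
      intro x hx y hy
      rw [hp.last] at hx
      simp only [List.head?_cons, Option.mem_def, Option.some.injEq] at hx hy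
      subst hx hy
      exact hc
    · rw [List.nodup_append]
      refine ⟨hp.nodup, by simp, ?_⟩
      rintro x hx y hy rfl
      simp only [List.mem_singleton] at hy
      exact hcp (hy ▸ hx)

end Lists

/-! ### Existence of maximal collections of shortest paths -/

section Maximal

variable {W : Type*} {H : Digraph W} {a b : W}

theorem IsPath.exists_isShortestPath {p : List W} (hp : IsPath H a b p) :
    ∃ q, IsShortestPath H a b q := by
  classical
  have hex : ∃ n, ∃ q, IsPath H a b q ∧ q.length = n := ⟨_, p, hp, rfl⟩
  obtain ⟨q, hq, hl⟩ := Nat.find_spec hex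
  exact ⟨q, hq, fun r hr => hl ▸ Nat.find_min' hex ⟨r, hr, rfl⟩⟩

theorem IsShortestPath.length_eq {p q : List W} (hp : IsShortestPath H a b p)
    (hq : IsShortestPath H a b q) : p.length = q.length :=
  le_antisymm (hp.2 q hq.1) (hq.2 p hp.1)

theorem finite_setOf_isShortestPath {T : Set W} (hT : T.Finite)
    (h : ∀ p, IsPath H a b p → ∀ x ∈ p, x ∈ T) : {p | IsShortestPath H a b p}.Finite := by
  by_cases hne : ∃ q, IsShortestPath H a b q
  · obtain ⟨q, hq⟩ := hne
    have := hT.to_subtype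
    refine ((List.finite_length_eq T q.length).image (List.map Subtype.val)).subset ?_
    intro p hp
    lift p to List T using h p hp.1
    exact ⟨p, by simpa using hp.length_eq hq, rfl⟩
  · convert Set.finite_empty
    ext q
    simpa using fun hq => hne ⟨q, hq⟩

theorem exists_isMaximalDisjointShortestPaths
    (hfin : {p | IsShortestPath H a b p}.Finite) {p : List W} (hp : IsPath H a b p) :
    ∃ P : List (List W), P ≠ [] ∧ P.Nodup ∧
      IsMaximalDisjointShortestPaths H a b {q | q ∈ P} := by
  classical
  obtain ⟨q, hq⟩ := hp.exists_isShortestPath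
  let C : Set (Set (List W)) := {P | P ⊆ {p | IsShortestPath H a b p} ∧ VertexDisjoint a b P}
  have hC : C.Finite := hfin.finite_subsets.subset fun P hP => hP.1
  have hqC : {q} ∈ C := by
    refine ⟨by simpa using hq, ?_⟩
    rintro x rfl y rfl hxy
    exact absurd rfl hxy
  obtain ⟨P, hqP, hP⟩ := hC.exists_le_maximal hqC
  have hPf : P.Finite := hfin.subset hP.1.1
  have heq : {p | p ∈ hPf.toFinset.toList} = P := by ext; simp
  refine ⟨hPf.toFinset.toList, ?_, hPf.toFinset.nodup_toList, ?_⟩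
  · have : q ∈ hPf.toFinset.toList := by simpa using hqP
    exact List.ne_nil_of_mem this
  · rw [heq]
    refine ⟨hP.1.1, hP.1.2, fun r hr hrs hd => hr ?_⟩
    exact hP.2 ⟨Set.insert_subset hrs hP.1.1, hd⟩ (Set.subset_insert _ _) (Set.mem_insert _ _)

end Maximal

/-! ### Strongly connected source components -/

section Components

variable {V : Type*} {G : Digraph V} {F : Set V} {M : Set (V × V)}

theorem IsSourceComponent.eq_of_mem {S Y : Set V} (hS : IsSourceComponent G S)
    (hY : IsSourceComponent G Y) {v : V} (hvS : v ∈ S) (hvY : v ∈ Y) : S = Y := by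
  obtain ⟨⟨a, rfl⟩, -⟩ := hS
  obtain ⟨⟨b, rfl⟩, -⟩ := hY
  obtain ⟨h1, h2⟩ := hvS
  obtain ⟨h3, h4⟩ := hvY
  ext w
  constructor
  · rintro ⟨h5, h6⟩
    exact ⟨(h3.trans h2).trans h5, (h6.trans h1).trans h4⟩
  · rintro ⟨h5, h6⟩
    exact ⟨(h1.trans h4).trans h5, (h6.trans h3).trans h2⟩

theorem IsSourceComponent.nonempty {S : Set V} (hS : IsSourceComponent G S) : S.Nonempty := by
  obtain ⟨⟨a, rfl⟩, -⟩ := hS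
  exact ⟨a, Relation.ReflTransGen.refl, Relation.ReflTransGen.refl⟩

theorem notMem_unmatched_of_mem {u v : V} (h : (u, v) ∈ M) : v ∉ unmatched M :=
  fun hv => hv u h

theorem exists_mem_of_notMem_unmatched {v : V} (h : v ∉ unmatched M) : ∃ u, (u, v) ∈ M := by
  simpa [unmatched] using h

theorem ncard_setOf_isSourceComponent_le [Finite V] [Nonempty V] :
    {S : Set V | IsSourceComponent G S}.ncard ≤ Nat.card V := by
  have h : ∀ S : Set V, IsSourceComponent G S → ∃ v, v ∈ S := fun S hS => hS.nonempty
  choose! f hf using h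
  rw [← Set.ncard_univ]
  refine Set.ncard_le_ncard_of_injOn f (fun _ _ => Set.mem_univ _) ?_ (Set.toFinite _)
  intro S hS Y hY hSY
  exact IsSourceComponent.eq_of_mem hS hY (hf S hS) (hSY ▸ hf Y hY)

end Components

/-! ### Edges of the flow graph -/

section FlowEdges

variable {V : Type*} {G : Digraph V} {F : Set V} {M : Set (V × V)}

theorem flowAdj_to_src {x : FlowVertex V} {u : V} (h : FlowAdj G F M x (.src u)) :
    (x = .s ∧ ∀ v, (u, v) ∉ M) ∨ ∃ v, x = .dst v ∧ (u, v) ∈ M := by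
  cases h with
  | split x _ h => cases h with | backward _ v _ h => exact .inr ⟨v, rfl, h⟩
  | source _ h => exact .inl ⟨rfl, h⟩

theorem flowAdj_to_dst {x : FlowVertex V} {b : V} (h : FlowAdj G F M x (.dst b)) :
    (∃ u, x = .src u ∧ G.Adj u b ∧ (u, b) ∉ M) ∨
    (∃ Y a, x = .dst a ∧ IsSourceComponent G Y ∧ Y ∩ unmatched M = {a} ∧ b ∈ Y ∧ b ∉ F) ∨
    ∃ X, x = .comp X ∧ IsSourceComponent G X ∧ X ∩ unmatched M = ∅ ∧ b ∈ X ∧ b ∉ F := by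
  cases h with
  | split x _ h =>
    cases h with
    | forward u _ h1 h2 => exact .inl ⟨u, rfl, h1, h2⟩
    | shift Y a _ h1 h2 h3 h4 => exact .inr (.inl ⟨Y, a, rfl, h1, h2, h3, h4⟩)
  | fromComp X _ h1 h2 h3 h4 => exact .inr (.inr ⟨X, rfl, h1, h2, h3, h4⟩)

theorem flowAdj_to_comp {x : FlowVertex V} {X : Set V} (h : FlowAdj G F M x (.comp X)) :
    x = .s ∧ IsSourceComponent G X ∧ X ∩ unmatched M = ∅ := by
  cases h with | toComp _ h1 h2 => exact ⟨rfl, h1, h2⟩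

theorem flowAdj_to_extra {x : FlowVertex V} {S : Set V} {j : ℕ}
    (h : FlowAdj G F M x (.extra S j)) :
    ∃ a, x = .dst a ∧ IsSourceComponent G S ∧ a ∈ S ∩ unmatched M ∧
      j + 1 < (S ∩ unmatched M).ncard := by
  cases h with | toExtra _ a _ h1 h2 h3 => exact ⟨a, rfl, h1, h2, h3⟩

theorem flowAdj_to_t {x : FlowVertex V} (h : FlowAdj G F M x .t) :
    (∃ a, x = .dst a ∧ a ∈ unmatched M ∧ ∀ S, IsSourceComponent G S → a ∉ S) ∨
    ∃ S j, x = .extra S j ∧ IsSourceComponent G S ∧ j + 1 < (S ∩ unmatched M).ncard := by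
  cases h with
  | sink a h1 h2 => exact .inl ⟨a, rfl, h1, h2⟩
  | fromExtra S j h1 h2 => exact .inr ⟨S, j, rfl, h1, h2⟩

theorem not_flowAdj_to_s {x : FlowVertex V} : ¬ FlowAdj G F M x .s := nofun

theorem flowAdj_from_src {u : V} {y : FlowVertex V} (h : FlowAdj G F M (.src u) y) :
    ∃ v, y = .dst v ∧ G.Adj u v ∧ (u, v) ∉ M := by
  cases h with
  | split _ y h => cases h with | forward _ v h1 h2 => exact ⟨v, rfl, h1, h2⟩

theorem flowAdj_from_comp {X : Set V} {y : FlowVertex V} (h : FlowAdj G F M (.comp X) y) :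
    ∃ b, y = .dst b ∧ IsSourceComponent G X ∧ X ∩ unmatched M = ∅ ∧ b ∈ X ∧ b ∉ F := by
  cases h with | fromComp _ b h1 h2 h3 h4 => exact ⟨b, rfl, h1, h2, h3, h4⟩

/-- The edges leaving a destination node. -/
theorem flowAdj_from_dst {a : V} {y : FlowVertex V} (h : FlowAdj G F M (.dst a) y) :
    (∃ u, y = .src u ∧ (u, a) ∈ M) ∨
    a ∈ unmatched M ∧
    ((∃ Y b, y = .dst b ∧ IsSourceComponent G Y ∧ Y ∩ unmatched M = {a} ∧ b ∈ Y ∧ b ∉ F) ∨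
    (y = .t ∧ ∀ S, IsSourceComponent G S → a ∉ S) ∨
    ∃ S j, y = .extra S j ∧ IsSourceComponent G S ∧ a ∈ S ∧
      j + 1 < (S ∩ unmatched M).ncard) := by
  cases h with
  | split _ y h =>
    cases h with
    | backward u _ h1 h2 => exact .inl ⟨u, rfl, h2⟩
    | shift Y _ b h1 h2 h3 h4 =>
      have : a ∈ Y ∩ unmatched M := h2 ▸ rfl
      exact .inr ⟨this.2, .inl ⟨Y, b, rfl, h1, h2, h3, h4⟩⟩
  | sink _ h1 h2 => exact .inr ⟨h1, .inr (.inl ⟨rfl, h2⟩)⟩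
  | toExtra S _ j h1 h2 h3 => exact .inr ⟨h2.2, .inr (.inr ⟨S, j, rfl, h1, h2.1, h3⟩)⟩

end FlowEdges

/-! ### Unit flows -/

section UnitFlow

variable {V : Type*}

/-- `E` is the edge relation of a family of paths from `s` to `t` in the flow graph of `M` that are
disjoint outside the terminals. -/
structure IsUnitFlow (G : Digraph V) (F : Set V) (M : Set (V × V))
    (E : FlowVertex V → FlowVertex V → Prop) : Prop where
  adj : ∀ {x y}, E x y → FlowAdj G F M x y
  ne : ∀ {x y}, E x y → x ≠ y
  exists_succ : ∀ {x y}, E x y → y ≠ .t → ∃ z, E y z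
  exists_pred : ∀ {x y}, E x y → x ≠ .s → ∃ z, E z x
  succ_unique : ∀ {x y z}, E x y → E x z → x ≠ .s → y = z
  pred_unique : ∀ {x y z}, E x z → E y z → z ≠ .t → x = y

/-- The edges used by the paths of a list. -/
def pathEdges (P : List (List (FlowVertex V))) (x y : FlowVertex V) : Prop :=
  ∃ p ∈ P, [x, y] <:+: p

/-- The simultaneous augmentation of `M` along the edges of `E`. -/
def augmentEdges (M : Set (V × V)) (E : FlowVertex V → FlowVertex V → Prop) : Set (V × V) :=
  {e | e ∈ M ∧ ¬ E (.dst e.2) (.src e.1)} ∪ {e | E (.src e.1) (.dst e.2)}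

variable {G : Digraph V} {F : Set V} {M : Set (V × V)} {P : List (List (FlowVertex V))}

theorem isUnitFlow_pathEdges (hP : ∀ p ∈ P, IsPath (flowGraph G F M) .s .t p)
    (hd : VertexDisjoint (.s : FlowVertex V) .t {p | p ∈ P}) :
    IsUnitFlow G F M (pathEdges P) where
  adj := fun ⟨p, hp, h⟩ => (hP p hp).adj h
  ne := fun ⟨p, hp, h⟩ => ne_of_pair_infix (hP p hp).nodup h
  exists_succ := by
    rintro x y ⟨p, hp, h⟩ hy
    obtain ⟨z, hz⟩ := (hP p hp).exists_succ (mem_right_of_pair_infix h) hy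
    exact ⟨z, p, hp, hz⟩
  exists_pred := by
    rintro x y ⟨p, hp, h⟩ hx
    obtain ⟨z, hz⟩ := (hP p hp).exists_pred (mem_left_of_pair_infix h) hx
    exact ⟨z, p, hp, hz⟩
  succ_unique := by
    rintro x y z ⟨p, hp, h⟩ ⟨q, hq, h'⟩ hx
    have hpq : p = q := by
      by_contra hpq
      rcases hd p hp q hq hpq x (mem_left_of_pair_infix h) (mem_left_of_pair_infix h') with h1 | h1
      · exact hx h1
      · exact (hP p hp).left_ne h h1
    subst hpq
    exact pair_infix_right_unique (hP p hp).nodup h h'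
  pred_unique := by
    rintro x y z ⟨p, hp, h⟩ ⟨q, hq, h'⟩ hz
    have hpq : p = q := by
      by_contra hpq
      rcases hd p hp q hq hpq z (mem_right_of_pair_infix h) (mem_right_of_pair_infix h')
        with h1 | h1
      · exact (hP p hp).right_ne h h1
      · exact hz h1
    subst hpq
    exact pair_infix_left_unique (hP p hp).nodup h h'

/-- Removed edges lie in the reference matching `M'` and added edges lie outside it, so no path
undoes what another has added and the order is irrelevant. -/
theorem foldl_augment_eq {M' : Set (V × V)} (N : Set (V × V))
    (hb : ∀ p ∈ P, ∀ u v, [FlowVertex.dst v, .src u] <:+: p → (u, v) ∈ M')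
    (hf : ∀ p ∈ P, ∀ u v, [FlowVertex.src u, .dst v] <:+: p → (u, v) ∉ M') :
    P.foldl augment N = augmentEdges N (pathEdges P) := by
  induction P using List.reverseRecOn with
  | nil => ext e; simp [augmentEdges, pathEdges]
  | append_singleton P p ih =>
    rw [List.foldl_append, ih (fun q hq => hb q (by simp [hq])) (fun q hq => hf q (by simp [hq]))]
    ext ⟨u, v⟩
    simp only [List.foldl_cons, List.foldl_nil, augment, augmentEdges, pathEdges, Set.mem_union,
      Set.mem_ofPred_eq, List.mem_append, List.mem_singleton, or_and_right, exists_or,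
      exists_eq_left, not_or]
    have h1 := hb p (by simp) u v
    constructor
    · rintro ((⟨⟨h2, h3⟩, h4⟩ | ⟨h2, -⟩) | h2)
      · exact .inl ⟨h2, h3, h4⟩
      · exact .inr (.inl h2)
      · exact .inr (.inr h2)
    · rintro (⟨h2, h3, h4⟩ | ⟨q, hq, h2⟩ | h2)
      · exact .inl (.inl ⟨⟨h2, h3⟩, h4⟩)
      · exact .inl (.inr ⟨⟨q, hq, h2⟩, fun h5 => hf q (by simp [hq]) u v h2 (h1 h5)⟩)
      · exact .inr h2

end UnitFlow

/-! ### The cost in terms of matched sources -/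

section Cost

variable {V : Type*} {G : Digraph V} {F : Set V} {M : Set (V × V)}

theorem IsMatching.ncard_sources [Finite V] (hM : IsMatching G M) :
    {u | ∃ v, (u, v) ∈ M}.ncard = M.ncard := by
  have : {u | ∃ v, (u, v) ∈ M} = Prod.fst '' M := by ext; simp
  rw [this]
  exact Set.InjOn.ncard_image fun e he f hf h => hM.source_inj e he f hf h

theorem IsMatching.ncard_unmatched_add [Finite V] (hM : IsMatching G M) :
    (unmatched M).ncard + M.ncard = Nat.card V := by
  have h : (unmatched M)ᶜ = Prod.snd '' M := by ext; simp [unmatched]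
  rw [← Set.ncard_add_ncard_compl (unmatched M), h,
    Set.InjOn.ncard_image fun e he f hf h => hM.dest_inj e he f hf h]

theorem ncard_sourceComponents_eq [Finite V] (U : Set V) :
    {S : Set V | IsSourceComponent G S ∧ (S ∩ U).Nonempty}.ncard +
      {S : Set V | IsSourceComponent G S ∧ S ∩ U = ∅}.ncard =
      {S : Set V | IsSourceComponent G S}.ncard := by
  rw [← Set.ncard_union_eq _ (Set.toFinite _) (Set.toFinite _)]
  · congr 1
    ext S
    simp only [Set.mem_union, Set.mem_ofPred_eq, ← and_or_left, Set.nonempty_iff_ne_empty]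
    tauto
  · rw [Set.disjoint_left]
    rintro S ⟨-, h1⟩ ⟨-, h2⟩
    exact h1.ne_empty h2

/-- The right-hand side does not depend on `M`, which turns minimising the cost into a maximisation.
-/
theorem IsMatching.cost_add [Finite V] (hM : IsMatching G M) :
    cost G M + (M.ncard +
      {S : Set V | IsSourceComponent G S ∧ (S ∩ unmatched M).Nonempty}.ncard) =
      Nat.card V + {S : Set V | IsSourceComponent G S}.ncard := by
  rw [← ncard_sourceComponents_eq (G := G) (unmatched M), ← hM.ncard_unmatched_add, cost]
  omega

end Cost

/-! ### Augmentation along a unit flow -/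

section Augment

variable {V : Type*} {G : Digraph V} {F : Set V} {M : Set (V × V)}
  {E : FlowVertex V → FlowVertex V → Prop}

theorem mem_augmentEdges {u v : V} : (u, v) ∈ augmentEdges M E ↔
    ((u, v) ∈ M ∧ ¬ E (.dst v) (.src u)) ∨ E (.src u) (.dst v) := Iff.rfl

theorem IsUnitFlow.back_of_into_src (hE : IsUnitFlow G F M E) (hM : IsMatching G M)
    {x : FlowVertex V} {u v : V} (hx : E x (.src u)) (huv : (u, v) ∈ M) :
    E (.dst v) (.src u) := by
  rcases flowAdj_to_src (hE.adj hx) with ⟨-, h⟩ | ⟨w, rfl, hw⟩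
  · exact absurd huv (h v)
  · obtain rfl : w = v := congrArg Prod.snd (hM.source_inj _ hw _ huv rfl)
    exact hx

theorem IsUnitFlow.back_of_into_dst (hE : IsUnitFlow G F M E) (hM : IsMatching G M)
    {x : FlowVertex V} {u v : V} (hx : E x (.dst v)) (huv : (u, v) ∈ M) :
    E (.dst v) (.src u) := by
  obtain ⟨z, hz⟩ := hE.exists_succ hx nofun
  rcases flowAdj_from_dst (hE.adj hz) with ⟨w, rfl, hw⟩ | ⟨h, -⟩
  · obtain rfl : w = u := congrArg Prod.fst (hM.dest_inj _ hw _ huv rfl)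
    exact hz
  · exact absurd h (notMem_unmatched_of_mem huv)

theorem IsUnitFlow.exists_forward (hE : IsUnitFlow G F M E) {x : FlowVertex V} {u : V}
    (hx : E x (.src u)) : ∃ v, E (.src u) (.dst v) := by
  obtain ⟨z, hz⟩ := hE.exists_succ hx nofun
  obtain ⟨v, rfl, -⟩ := flowAdj_from_src (hE.adj hz)
  exact ⟨v, hz⟩

/-- After augmentation, the matching edge at a source node on the flow is new. -/
theorem IsUnitFlow.notMem_of_into_src (hE : IsUnitFlow G F M E) (hM : IsMatching G M)
    {x : FlowVertex V} {u v : V} (hx : E x (.src u)) (huv : (u, v) ∈ augmentEdges M E) :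
    (u, v) ∉ M := by
  intro h
  rcases mem_augmentEdges.1 huv with ⟨-, h'⟩ | h'
  · exact h' (hE.back_of_into_src hM hx h)
  · obtain ⟨w, hw, -, h2⟩ := flowAdj_from_src (hE.adj h')
    obtain rfl : v = w := by simpa using hw
    exact h2 h

/-- After augmentation, the matching edge at a destination node on the flow is new. -/
theorem IsUnitFlow.notMem_of_into_dst (hE : IsUnitFlow G F M E) (hM : IsMatching G M)
    {x : FlowVertex V} {u v : V} (hx : E x (.dst v)) (huv : (u, v) ∈ augmentEdges M E) :
    (u, v) ∉ M := by
  intro h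
  have hb := hE.back_of_into_dst hM hx h
  exact hE.notMem_of_into_src hM hb huv h

/-- The reversed `M`-edge is the only way into a matched source node and the only way out of a
matched destination node. Hence at a node on the flow the old matching edge is removed, and
disjointness of the paths leaves room for at most one new edge. -/
theorem IsUnitFlow.isMatching (hE : IsUnitFlow G F M E) (hM : IsMatching G M) :
    IsMatching G (augmentEdges M E) where
  adj := by
    rintro ⟨u, v⟩ (⟨h, -⟩ | h)
    · exact hM.adj _ h
    · obtain ⟨w, hw, h1, -⟩ := flowAdj_from_src (hE.adj h)
      obtain rfl : v = w := by simpa using hw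
      exact h1
  source_inj := by
    rintro ⟨u, v⟩ h1 ⟨u', v'⟩ h2 rfl
    have key : ∀ {w w'}, (u, w) ∈ augmentEdges M E → E (.src u) (.dst w') → w = w' := by
      intro w w' h h'
      obtain ⟨x, hx⟩ := hE.exists_pred h' nofun
      rcases mem_augmentEdges.1 h with ⟨h3, h4⟩ | h3
      · exact absurd (hE.back_of_into_src hM hx h3) h4
      · simpa using hE.succ_unique h3 h' nofun
    rcases mem_augmentEdges.1 h1 with ⟨h3, -⟩ | h3
    · rcases mem_augmentEdges.1 h2 with ⟨h4, -⟩ | h4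
      · exact hM.source_inj _ h3 _ h4 rfl
      · rw [key h1 h4]
    · rw [key h2 h3]
  dest_inj := by
    rintro ⟨u, v⟩ h1 ⟨u', v'⟩ h2 rfl
    have key : ∀ {w w'}, (w, v) ∈ augmentEdges M E → E (.src w') (.dst v) → w = w' := by
      intro w w' h h'
      rcases mem_augmentEdges.1 h with ⟨h3, h4⟩ | h3
      · exact absurd (hE.back_of_into_dst hM h' h3) h4
      · simpa using hE.pred_unique h3 h' nofun
    rcases mem_augmentEdges.1 h1 with ⟨h3, -⟩ | h3
    · rcases mem_augmentEdges.1 h2 with ⟨h4, -⟩ | h4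
      · exact hM.dest_inj _ h3 _ h4 rfl
      · rw [key h1 h4]
    · rw [key h2 h3]

theorem IsUnitFlow.exists_mem_augmentEdges (hE : IsUnitFlow G F M E) {u v : V}
    (h : (u, v) ∈ M) : ∃ w, (u, w) ∈ augmentEdges M E := by
  by_cases hb : E (.dst v) (.src u)
  · obtain ⟨w, hw⟩ := hE.exists_forward hb
    exact ⟨w, .inr hw⟩
  · exact ⟨v, .inl ⟨h, hb⟩⟩

theorem IsUnitFlow.mem_unmatched_of_into (hE : IsUnitFlow G F M E) (hM : IsMatching G M)
    {x : FlowVertex V} {v : V} (hx : E x (.dst v)) (hne : ∀ u, x ≠ .src u) :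
    v ∈ unmatched (augmentEdges M E) := by
  intro u hu
  rcases mem_augmentEdges.1 hu with ⟨h3, h4⟩ | h3
  · exact h4 (hE.back_of_into_dst hM hx h3)
  · exact hne u (hE.pred_unique hx h3 nofun)

theorem mem_unmatched_augmentEdges {v : V}
    (hv : v ∈ unmatched M) (hx : ∀ x, ¬ E x (.dst v)) : v ∈ unmatched (augmentEdges M E) := by
  intro u hu
  rcases mem_augmentEdges.1 hu with ⟨h3, h4⟩ | h3
  · exact hv u h3
  · exact hx _ h3

/-- An unmatched vertex of the augmented matching either was unmatched and is not on the flow, or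
the flow ends the excursion into its source component there. -/
theorem IsUnitFlow.unmatched_cases (hE : IsUnitFlow G F M E) {v : V}
    (hv : v ∈ unmatched (augmentEdges M E)) :
    (v ∈ unmatched M ∧ ∀ x, ¬ E x (.dst v)) ∨
    v ∉ unmatched M ∧ v ∉ F ∧ ∃ S, IsSourceComponent G S ∧ v ∈ S ∧
      ((∃ a, S ∩ unmatched M = {a} ∧ E (.dst a) (.dst v)) ∨
        (S ∩ unmatched M = ∅ ∧ E (.comp S) (.dst v))) := by
  by_cases hx : ∃ x, E x (.dst v)
  · obtain ⟨x, hx⟩ := hx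
    rcases flowAdj_to_dst (hE.adj hx) with ⟨u, rfl, -⟩ | ⟨Y, a, rfl, h1, h2, h3, h4⟩ |
      ⟨X, rfl, h1, h2, h3, h4⟩
    · exact absurd (Or.inr hx) (hv u)
    · refine .inr ⟨fun hvU => ?_, h4, Y, h1, h3, .inl ⟨a, h2, hx⟩⟩
      have : v ∈ Y ∩ unmatched M := ⟨h3, hvU⟩
      rw [h2] at this
      obtain rfl : v = a := this
      exact hE.ne hx rfl
    · refine .inr ⟨fun hvU => ?_, h4, X, h1, h3, .inr ⟨h2, hx⟩⟩
      have : v ∈ X ∩ unmatched M := ⟨h3, hvU⟩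
      rw [h2] at this
      exact this
  · refine .inl ⟨fun u hu => ?_, fun x hx' => hx ⟨x, hx'⟩⟩
    have hb : E (.dst v) (.src u) := by
      by_contra hb
      exact hv u (.inl ⟨hu, hb⟩)
    exact hx (hE.exists_pred hb nofun)

theorem IsUnitFlow.not_into_of_mem_unmatched (hE : IsUnitFlow G F M E) {v : V}
    (hv : v ∈ unmatched (augmentEdges M E)) (hvU : v ∈ unmatched M) (x : FlowVertex V) :
    ¬ E x (.dst v) := by
  rcases hE.unmatched_cases hv with ⟨-, h⟩ | ⟨h, -⟩
  · exact h x
  · exact absurd hvU h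

theorem IsUnitFlow.isAllowedMatching (hE : IsUnitFlow G F M E) (hM : IsAllowedMatching G F M) :
    IsAllowedMatching G F (augmentEdges M E) := by
  refine ⟨hE.isMatching hM.1, ?_⟩
  rw [Set.eq_empty_iff_forall_notMem]
  rintro v ⟨hv, hvF⟩
  rcases hE.unmatched_cases hv with ⟨h, -⟩ | ⟨-, h, -⟩
  · have : v ∈ unmatched M ∩ F := ⟨h, hvF⟩
    rw [hM.2] at this
    exact this
  · exact h hvF

/-- A vertex of `S` becomes unmatched only when the flow enters it from the sole unmatched vertex of
`S`, which thereby gets matched, or from `comp S`, when there was none. Either node has only one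
outgoing flow edge. -/
theorem IsUnitFlow.inter_unmatched_eq_singleton (hE : IsUnitFlow G F M E) {S : Set V}
    (hS : IsSourceComponent G S) {v : V} (hvS : v ∈ S)
    (hv : v ∈ unmatched (augmentEdges M E)) (hvU : v ∉ unmatched M) :
    S ∩ unmatched (augmentEdges M E) = {v} := by
  refine Set.eq_singleton_iff_unique_mem.2 ⟨⟨hvS, hv⟩, ?_⟩
  rintro w ⟨hwS, hw⟩
  rcases hE.unmatched_cases hv with ⟨h, -⟩ | ⟨-, -, Y, hY, hvY, h⟩
  · exact absurd h hvU
  obtain rfl := hY.eq_of_mem hS hvY hvS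
  rcases hE.unmatched_cases hw with ⟨hwU, h'⟩ | ⟨-, -, Z, hZ, hwZ, h'⟩
  · have hwm : w ∈ Y ∩ unmatched M := ⟨hwS, hwU⟩
    rcases h with ⟨a, ha, h⟩ | ⟨h1, -⟩
    · rw [ha] at hwm
      obtain rfl : w = a := hwm
      obtain ⟨z, hz⟩ := hE.exists_pred h nofun
      exact absurd hz (h' z)
    · rw [h1] at hwm
      exact absurd hwm (Set.notMem_empty _)
  · obtain rfl := hZ.eq_of_mem hS hwZ hwS
    rcases h with ⟨a, ha, h⟩ | ⟨h1, h⟩ <;> rcases h' with ⟨b, hb, h'⟩ | ⟨h2, h'⟩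
    · obtain rfl : a = b := Set.singleton_injective (ha.symm.trans hb)
      simpa using hE.succ_unique h' h nofun
    · exact absurd (ha.symm.trans h2) (Set.singleton_ne_empty _)
    · exact absurd (hb.symm.trans h1) (Set.singleton_ne_empty _)
    · simpa using hE.succ_unique h' h nofun

theorem IsUnitFlow.inter_unmatched_nonempty [Finite V] (hE : IsUnitFlow G F M E)
    (hM : IsMatching G M) {S : Set V} (hS : IsSourceComponent G S)
    (hne : (S ∩ unmatched M).Nonempty) : (S ∩ unmatched (augmentEdges M E)).Nonempty := by
  by_contra hcon
  -- If all unmatched vertices were lost, the flow would pass through each of them. Leaving by a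
  -- shift edge would unmatch another vertex of `S`, so each would need its own extra node, and
  -- there is one too few.
  have h : ∀ a ∈ S ∩ unmatched M, ∃ j ∈ Finset.range ((S ∩ unmatched M).ncard - 1),
      E (.dst a) (.extra S j) := by
    rintro a ⟨haS, haU⟩
    have hx : ∃ x, E x (.dst a) := by
      by_contra hx
      exact hcon ⟨a, haS, mem_unmatched_augmentEdges haU fun x h => hx ⟨x, h⟩⟩
    obtain ⟨x, hx⟩ := hx
    obtain ⟨z, hz⟩ := hE.exists_succ hx nofun
    rcases flowAdj_from_dst (hE.adj hz) with ⟨w, rfl, hw⟩ | ⟨-, ⟨Y, b, rfl, h1, h2, h3, -⟩ |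
      ⟨rfl, h⟩ | ⟨Y, j, rfl, h1, h2, h3⟩⟩
    · exact absurd hw (haU w)
    · have haY : a ∈ Y ∩ unmatched M := h2 ▸ rfl
      obtain rfl := h1.eq_of_mem hS haY.1 haS
      exact absurd ⟨b, h3, hE.mem_unmatched_of_into hM hz nofun⟩ hcon
    · exact absurd haS (h S hS)
    · obtain rfl := h1.eq_of_mem hS h2 haS
      exact ⟨j, by rw [Finset.mem_range]; omega, hz⟩
  have hcard := Finset.card_le_card_of_forall_subsingleton
    (s := (Set.toFinite (S ∩ unmatched M)).toFinset)
    (t := Finset.range ((S ∩ unmatched M).ncard - 1))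
    (fun a j => E (.dst a) (.extra S j)) (by simpa using h) (by
      rintro j - a ⟨-, ha⟩ b ⟨-, hb⟩
      simpa using hE.pred_unique ha hb nofun)
  rw [← Set.ncard_eq_toFinset_card, Finset.card_range] at hcard
  have := (Set.ncard_pos (Set.toFinite _)).2 hne
  omega

theorem IsUnitFlow.inter_unmatched_subset [Finite V] (hE : IsUnitFlow G F M E) {S : Set V}
    (hS : IsSourceComponent G S) (h2 : 2 ≤ (S ∩ unmatched (augmentEdges M E)).ncard) :
    S ∩ unmatched (augmentEdges M E) ⊆ S ∩ unmatched M := by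
  rintro v ⟨hvS, hv⟩
  refine ⟨hvS, ?_⟩
  by_contra hvU
  rw [hE.inter_unmatched_eq_singleton hS hvS hv hvU, Set.ncard_singleton] at h2
  omega

/-- If the source component `S` keeps two unmatched vertices, then one of its extra nodes is not on
the flow. -/
theorem IsUnitFlow.exists_extra_not_into [Finite V] (hE : IsUnitFlow G F M E) {S : Set V}
    (hS : IsSourceComponent G S) (h2 : 2 ≤ (S ∩ unmatched (augmentEdges M E)).ncard) :
    ∃ j, j + 1 < (S ∩ unmatched M).ncard ∧ ∀ x, ¬ E x (.extra S j) := by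
  by_contra! hcon
  have hsub := hE.inter_unmatched_subset hS h2
  have hdiff := Set.ncard_sdiff_add_ncard_of_subset hsub (Set.toFinite _)
  -- If every extra node were used, each would account for a different unmatched vertex that is
  -- lost. That is a loss of `k - 1` out of `k`, leaving at most one.
  have hcard := Finset.card_le_card_of_forall_subsingleton
    (s := Finset.range ((S ∩ unmatched M).ncard - 1))
    (t := (Set.toFinite ((S ∩ unmatched M) \ (S ∩ unmatched (augmentEdges M E)))).toFinset)
    (fun j a => E (.dst a) (.extra S j)) (by
      intro j hj
      rw [Finset.mem_range] at hj
      obtain ⟨x, hx⟩ := hcon j (by omega)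
      obtain ⟨a, rfl, -, haS, -⟩ := flowAdj_to_extra (hE.adj hx)
      obtain ⟨z, hz⟩ := hE.exists_pred hx nofun
      refine ⟨a, ?_, hx⟩
      simp only [Set.Finite.mem_toFinset]
      exact ⟨haS, fun h => hE.not_into_of_mem_unmatched h.2 haS.2 z hz⟩) (by
      rintro a - i ⟨-, hi⟩ j ⟨-, hj⟩
      simpa using hE.succ_unique hi hj nofun)
  rw [← Set.ncard_eq_toFinset_card, Finset.card_range] at hcard
  omega

/-- Matched sources and hit components both persist, and the head of the flow edge at `s` makes one
of the two inclusions strict. -/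
theorem IsUnitFlow.cost_lt [Finite V] (hE : IsUnitFlow G F M E) (hM : IsMatching G M)
    {x : FlowVertex V} (hx : E .s x) : cost G (augmentEdges M E) < cost G M := by
  have h1 := hM.cost_add
  have h2 := (hE.isMatching hM).cost_add
  rw [← IsMatching.ncard_sources hM] at h1
  rw [← IsMatching.ncard_sources (hE.isMatching hM)] at h2
  have hsub1 : {u | ∃ v, (u, v) ∈ M} ⊆ {u | ∃ v, (u, v) ∈ augmentEdges M E} :=
    fun u ⟨v, h⟩ => hE.exists_mem_augmentEdges h
  have hsub2 : {S : Set V | IsSourceComponent G S ∧ (S ∩ unmatched M).Nonempty} ⊆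
      {S : Set V | IsSourceComponent G S ∧ (S ∩ unmatched (augmentEdges M E)).Nonempty} :=
    fun S hS => ⟨hS.1, hE.inter_unmatched_nonempty hM hS.1 hS.2⟩
  have hle1 := Set.ncard_le_ncard hsub1 (Set.toFinite _)
  have hle2 := Set.ncard_le_ncard hsub2 (Set.toFinite _)
  have hadj := hE.adj hx
  cases hadj with
  | source u hu =>
    have : {u | ∃ v, (u, v) ∈ M} ⊂ {u | ∃ v, (u, v) ∈ augmentEdges M E} := by
      refine ⟨hsub1, fun h => ?_⟩
      obtain ⟨v, hv⟩ := hE.exists_forward hx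
      obtain ⟨w, hw⟩ := h ⟨v, .inr hv⟩
      exact hu w hw
    have := Set.ncard_lt_ncard this (Set.toFinite _)
    omega
  | toComp X hX hXU =>
    have : {S : Set V | IsSourceComponent G S ∧ (S ∩ unmatched M).Nonempty} ⊂
        {S : Set V | IsSourceComponent G S ∧ (S ∩ unmatched (augmentEdges M E)).Nonempty} := by
      refine ⟨hsub2, fun h => ?_⟩
      obtain ⟨z, hz⟩ := hE.exists_succ hx nofun
      obtain ⟨b, rfl, -, -, hb, -⟩ := flowAdj_from_comp (hE.adj hz)
      exact (h ⟨hX, b, hb, hE.mem_unmatched_of_into hM hz nofun⟩).2.ne_empty hXU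
    have := Set.ncard_lt_ncard this (Set.toFinite _)
    omega

end Augment

/-! ### Truncated distances from `s` -/

section Level

variable {V : Type*}

open Classical in
/-- The value at which the distance from `s` is truncated, when the distance from `s` to `t` is
`D`. -/
noncomputable def levelCap (G : Digraph V) (D : ℕ) : FlowVertex V → ℕ
  | .t => D
  | .core (.dst b) => if ∃ S, IsSourceComponent G S ∧ b ∈ S then D - 2 else D - 1
  | _ => D - 1

/-- The truncated distance from `s` in the flow graph of `M`. -/
noncomputable def level (G : Digraph V) (F : Set V) (M : Set (V × V)) (D : ℕ)
    (x : FlowVertex V) : ℕ :=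
  sInf ({n | ∃ p, IsPath (flowGraph G F M) .s x p ∧ p.length = n + 1} ∪ {levelCap G D x})

variable {G : Digraph V} {F : Set V} {M : Set (V × V)} {D : ℕ}

theorem levelCap_le (x : FlowVertex V) (hx : x ≠ .t) : levelCap G D x ≤ D - 1 := by
  rcases x with (_ | b) | _ | _ | _ | _ <;> simp only [levelCap, le_refl]
  · split_ifs <;> omega
  · exact absurd rfl hx

theorem le_levelCap (x : FlowVertex V) : D - 2 ≤ levelCap G D x := by
  rcases x with (_ | b) | _ | _ | _ | _ <;> simp only [levelCap] <;> try omega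
  split_ifs <;> omega

theorem levelCap_dst {S : Set V} (hS : IsSourceComponent G S) {b : V} (hb : b ∈ S) :
    levelCap G D (.dst b) = D - 2 :=
  if_pos ⟨S, hS, hb⟩

/-- Away from `t` all caps are `D - 1` or `D - 2`, so only edges into `t` need care. Destination
nodes in source components have no edge to `t`, which is why their cap may be the lower one. -/
theorem levelCap_le_add_one {x y : FlowVertex V} (h : FlowAdj G F M x y) :
    levelCap G D y ≤ levelCap G D x + 1 := by
  by_cases hy : y = .t
  · subst hy
    rcases flowAdj_to_t h with ⟨a, rfl, -, ha⟩ | ⟨S, j, rfl, -⟩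
    · have : levelCap G D (.dst a) = D - 1 := if_neg (by simpa using ha)
      rw [this]
      simp only [levelCap]
      omega
    · simp only [levelCap]
      omega
  · have h1 := levelCap_le (G := G) (D := D) y hy
    have h2 := le_levelCap (G := G) (D := D) x
    omega

theorem level_mem (x : FlowVertex V) :
    (∃ p, IsPath (flowGraph G F M) .s x p ∧ p.length = level G F M D x + 1) ∨
      level G F M D x = levelCap G D x :=
  Nat.sInf_mem (s := {n | ∃ p, IsPath (flowGraph G F M) .s x p ∧ p.length = n + 1} ∪
    {levelCap G D x}) ⟨_, .inr rfl⟩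

theorem level_le_levelCap (x : FlowVertex V) : level G F M D x ≤ levelCap G D x :=
  Nat.sInf_le (.inr rfl)

theorem level_le_of_isPath {x : FlowVertex V} {p : List (FlowVertex V)} {n : ℕ}
    (hp : IsPath (flowGraph G F M) .s x p) (hn : p.length ≤ n + 1) : level G F M D x ≤ n := by
  have h0 := List.length_pos_of_mem hp.head_mem
  refine (Nat.sInf_le (.inl ⟨p, hp, ?_⟩)).trans (Nat.sub_le_of_le_add hn)
  omega

theorem level_s : level G F M D .s = 0 :=
  Nat.le_zero.1 (level_le_of_isPath (isPath_singleton _ _) (by simp))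

theorem level_le_add_one {x y : FlowVertex V} (h : FlowAdj G F M x y) :
    level G F M D y ≤ level G F M D x + 1 := by
  rcases level_mem (G := G) (F := F) (M := M) (D := D) x with ⟨p, hp, hl⟩ | hx
  · obtain ⟨q, hq, hql⟩ := hp.exists_extend h
    exact level_le_of_isPath hq (by omega)
  · rw [hx]
    exact (level_le_levelCap y).trans (levelCap_le_add_one h)

theorem level_t (hD : ∀ p, IsPath (flowGraph G F M) .s .t p → D + 1 ≤ p.length) :
    level G F M D .t = D := by
  rcases level_mem (G := G) (F := F) (M := M) (D := D) .t with ⟨p, hp, hl⟩ | hx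
  · refine le_antisymm (level_le_levelCap _) ?_
    have := hD p hp
    omega
  · exact hx

/-- A level below the cap is an actual path length. This keeps the unused `comp` nodes out of the
count of nodes at low levels. -/
theorem exists_flowAdj_of_level_lt {x : FlowVertex V} (hx : x ≠ .s)
    (h : level G F M D x < levelCap G D x) : ∃ y, FlowAdj G F M y x := by
  rcases level_mem (G := G) (F := F) (M := M) (D := D) x with ⟨p, hp, -⟩ | hx'
  · obtain ⟨y, hy⟩ := hp.exists_pred hp.last_mem hx
    exact ⟨y, hp.adj hy⟩
  · omega

variable {E : FlowVertex V → FlowVertex V → Prop}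

/-- The edges that an augmentation creates do not lead to a higher level. -/
theorem IsUnitFlow.flowAdj_or_level_le [Finite V] (hE : IsUnitFlow G F M E) (hM : IsMatching G M)
    (ht : level G F M D .t = D)
    (htight : ∀ x y, E x y → level G F M D y = level G F M D x + 1) {x y : FlowVertex V}
    (h : FlowAdj G F (augmentEdges M E) x y) :
    FlowAdj G F M x y ∨ level G F M D y ≤ level G F M D x := by
  have hempty : ∀ {S}, IsSourceComponent G S → S ∩ unmatched (augmentEdges M E) = ∅ →
      S ∩ unmatched M = ∅ := by
    intro S hS h
    by_contra hne
    exact (hE.inter_unmatched_nonempty hM hS (Set.nonempty_iff_ne_empty.2 hne)).ne_empty h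
  have hcard : ∀ {S} {j : ℕ}, IsSourceComponent G S →
      j + 1 < (S ∩ unmatched (augmentEdges M E)).ncard → j + 1 < (S ∩ unmatched M).ncard :=
    fun hS hj => hj.trans_le
      (Set.ncard_le_ncard (hE.inter_unmatched_subset hS (by omega)) (Set.toFinite _))
  cases h with
  | split x y h =>
    cases h with
    | forward u v h1 h2 =>
      by_cases huv : (u, v) ∈ M
      · right
        change level G F M D (.dst v) ≤ level G F M D (.src u)
        have hb : E (.dst v) (.src u) := by
          by_contra hb
          exact h2 (.inl ⟨huv, hb⟩)
        have := htight _ _ hb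
        omega
      · exact .inl (.split _ _ (.forward u v h1 huv))
    | backward u v h1 h2 =>
      rcases mem_augmentEdges.1 h2 with ⟨h3, -⟩ | h3
      · exact .inl (.split _ _ (.backward u v h1 h3))
      · have := htight _ _ h3
        right
        change level G F M D (.src u) ≤ level G F M D (.dst v)
        omega
    | shift Y a b hY ha hb hbF =>
      have haY : a ∈ Y ∩ unmatched (augmentEdges M E) := ha ▸ rfl
      rcases hE.unmatched_cases haY.2 with ⟨haU, hx⟩ | ⟨-, -, S, hS, haS, h'⟩
      · by_cases h1 : Y ∩ unmatched M = {a}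
        · exact .inl (.split _ _ (.shift Y a b hY h1 hb hbF))
        right
        change level G F M D (.dst b) ≤ level G F M D (.dst a)
        -- The component dropped from several unmatched vertices to `a` alone. Before that, `t` was
        -- two edges from `dst a` through an extra node, so `dst a` has level at least `D - 2`, the
        -- cap at `dst b`.
        have hk : 0 + 1 < (Y ∩ unmatched M).ncard := by
          have h2 : 0 < (Y ∩ unmatched M).ncard :=
            (Set.ncard_pos (Set.toFinite _)).2 ⟨a, haY.1, haU⟩
          by_contra h3
          obtain ⟨c, hc⟩ := Set.ncard_eq_one.1 (show (Y ∩ unmatched M).ncard = 1 by omega)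
          have : a ∈ Y ∩ unmatched M := ⟨haY.1, haU⟩
          rw [hc] at this
          obtain rfl : a = c := this
          exact h1 hc
        have h2 := level_le_add_one (D := D) (FlowAdj.toExtra (F := F) Y a 0 hY ⟨haY.1, haU⟩ hk)
        have h3 := level_le_add_one (D := D) (FlowAdj.fromExtra (F := F) Y 0 hY hk)
        have h4 := level_le_levelCap (G := G) (F := F) (M := M) (D := D) (.dst b)
        rw [levelCap_dst hY hb] at h4
        omega
      · right
        change level G F M D (.dst b) ≤ level G F M D (.dst a)
        obtain rfl := hS.eq_of_mem hY haS haY.1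
        -- Here `a` is newly unmatched. The node from which the flow entered `dst a` also had an
        -- edge to `dst b`, so `dst b` is no higher than `dst a`.
        rcases h' with ⟨c, hc, h'⟩ | ⟨hc, h'⟩
        · have h2 : level G F M D (.dst b) ≤ level G F M D (.dst c) + 1 :=
            level_le_add_one (FlowAdj.split _ _ (.shift S c b hY hc hb hbF))
          have := htight _ _ h'
          omega
        · have h2 := level_le_add_one (D := D) (FlowAdj.fromComp S b hY hc hb hbF)
          have := htight _ _ h'
          omega
  | source u h =>
    refine .inl (.source u fun v hv => ?_)
    obtain ⟨w, hw⟩ := hE.exists_mem_augmentEdges hv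
    exact h w hw
  | toComp X hX h => exact .inl (.toComp X hX (hempty hX h))
  | fromComp X b hX h hb hbF => exact .inl (.fromComp X b hX (hempty hX h) hb hbF)
  | sink a ha h =>
    rcases hE.unmatched_cases ha with ⟨haU, -⟩ | ⟨-, -, S, hS, haS, -⟩
    · exact .inl (.sink a haU h)
    · exact absurd haS (h S hS)
  | toExtra S a j hS ha hj =>
    exact .inl (.toExtra S a j hS (hE.inter_unmatched_subset hS (by omega) ha) (hcard hS hj))
  | fromExtra S j hS hj => exact .inl (.fromExtra S j hS (hcard hS hj))

end Level

/-! ### The distance from `s` to `t` increases -/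

section Distance

variable {V : Type*} {G : Digraph V} {F : Set V} {M : Set (V × V)}
  {E : FlowVertex V → FlowVertex V → Prop}

/-- A path that survives the augmentation avoids the flow, except possibly at extra nodes. -/
theorem IsUnitFlow.not_into_of_isPath [Finite V] (hE : IsUnitFlow G F M E) (hM : IsMatching G M)
    {q : List (FlowVertex V)} (hq : IsPath (flowGraph G F (augmentEdges M E)) .s .t q)
    (hold : ∀ x y, [x, y] <:+: q → FlowAdj G F M x y) {z : FlowVertex V} (hz : z ∈ q)
    (hzt : z ≠ .t) (hze : ∀ S j, z ≠ .extra S j) (w : FlowVertex V) : ¬ E w z := by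
  intro hw
  have hzs : z ≠ .s := by
    rintro rfl
    exact not_flowAdj_to_s (hE.adj hw)
  obtain ⟨x, hx⟩ := hq.exists_pred hz hzs
  obtain ⟨y, hy⟩ := hq.exists_succ hz hzt
  have hx1 := hold _ _ hx
  have hx2 : FlowAdj G F _ _ _ := hq.adj hx
  have hy1 := hold _ _ hy
  have hy2 : FlowAdj G F _ _ _ := hq.adj hy
  rcases z with (u | v) | _ | _ | X | ⟨S, j⟩
  -- The edges of `q` exist both before and after the augmentation, whereas the matching edge at a
  -- split node on the flow changes: it cannot belong to both matchings.
  · rcases flowAdj_to_src hx2 with ⟨-, h⟩ | ⟨v, rfl, h⟩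
    · obtain ⟨v, hv⟩ := hE.exists_forward hw
      exact h v (.inr hv)
    · rcases flowAdj_to_src hx1 with ⟨h', -⟩ | ⟨v', hv', h'⟩
      · cases h'
      · obtain rfl : v = v' := by simpa using hv'
        exact hE.notMem_of_into_src hM hw h h'
  · rcases flowAdj_from_dst hy1 with ⟨u, rfl, h⟩ | ⟨hv, h⟩
    · rcases flowAdj_from_dst hy2 with ⟨u', hu', h'⟩ | ⟨hv', h'⟩
      · obtain rfl : u = u' := by simpa using hu'
        exact hE.notMem_of_into_dst hM hw h' h
      · rcases h' with ⟨_, _, h', -⟩ | ⟨h', -⟩ | ⟨_, _, h', -⟩ <;> cases h'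
    · rcases flowAdj_from_dst hy2 with ⟨u', rfl, h'⟩ | ⟨hv', -⟩
      · rcases h with ⟨_, _, h', -⟩ | ⟨h', -⟩ | ⟨_, _, h', -⟩ <;> cases h'
      · exact hE.not_into_of_mem_unmatched hv' hv w hw
  · exact hzs rfl
  · exact hzt rfl
  · obtain ⟨-, hX, hXU⟩ := flowAdj_to_comp hx2
    obtain ⟨c, hc⟩ := hE.exists_succ hw nofun
    obtain ⟨b, rfl, -, -, hb, -⟩ := flowAdj_from_comp (hE.adj hc)
    have : b ∈ X ∩ unmatched (augmentEdges M E) := ⟨hb, hE.mem_unmatched_of_into hM hc nofun⟩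
    rw [hXU] at this
    exact this
  · exact hze S j rfl

/-- Replacing every extra node of a component `S` by the one with index `f S`. -/
def reindexExtra (f : Set V → ℕ) : FlowVertex V → FlowVertex V
  | .extra S _ => .extra S (f S)
  | x => x

theorem flowAdj_reindexExtra {f : Set V → ℕ} {x y : FlowVertex V} (h : FlowAdj G F M x y)
    (hf : ∀ S j, x = .extra S j ∨ y = .extra S j → f S + 1 < (S ∩ unmatched M).ncard) :
    FlowAdj G F M (reindexExtra f x) (reindexExtra f y) := by
  cases h with
  | split x y h => exact .split x y h
  | source u h => exact .source u h
  | toComp X h1 h2 => exact .toComp X h1 h2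
  | fromComp X b h1 h2 h3 h4 => exact .fromComp X b h1 h2 h3 h4
  | sink a h1 h2 => exact .sink a h1 h2
  | toExtra S a j h1 h2 h3 => exact .toExtra S a _ h1 h2 (hf S j (.inr rfl))
  | fromExtra S j h1 h2 => exact .fromExtra S _ h1 (hf S j (.inl rfl))

/-- Levels give "at least as long". In case of equality every edge of `q` climbs one level and is
therefore old, and `q`, with its extra node replaced by a free one, could be added to the maximal
collection. -/
theorem lt_length_of_isPath_augmentEdges [Finite V] (hM : IsMatching G M)
    {P : List (List (FlowVertex V))}
    (hP : IsMaximalDisjointShortestPaths (flowGraph G F M) .s .t {p | p ∈ P})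
    {p q : List (FlowVertex V)} (hp : IsShortestPath (flowGraph G F M) .s .t p)
    (hq : IsPath (flowGraph G F (augmentEdges M (pathEdges P))) .s .t q) :
    p.length < q.length := by
  set E := pathEdges P with hEdef
  have hE : IsUnitFlow G F M E := isUnitFlow_pathEdges (fun p hp => (hP.shortest p hp).1) hP.disjoint
  obtain ⟨D, hD⟩ : ∃ D, p.length = D + 1 :=
    ⟨p.length - 1, by have := List.length_pos_of_mem hp.1.head_mem; omega⟩
  have ht : level G F M D .t = D := level_t fun r hr => hD ▸ hp.2 r hr
  have htight : ∀ x y, E x y → level G F M D y = level G F M D x + 1 := by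
    rintro x y ⟨r, hr, hxy⟩
    have hr' := hP.shortest r hr
    exact potential_tight (fun x y h => level_le_add_one (hr'.1.adj h)) hr'.1.head hr'.1.last
      level_s (by rw [ht, ← hD, hr'.length_eq hp]) hxy
  have hstep : ∀ x y, [x, y] <:+: q → level G F M D y ≤ level G F M D x + 1 := by
    intro x y hxy
    rcases hE.flowAdj_or_level_le hM ht htight (hq.adj hxy) with h | h
    · exact level_le_add_one h
    · omega
  have hge := potential_add_one_le_length hstep hq.head hq.last level_s
  rw [ht] at hge
  by_contra hlt
  have hql : q.length = D + 1 := by omega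
  have hold : ∀ x y, [x, y] <:+: q → FlowAdj G F M x y := by
    intro x y hxy
    have := potential_tight hstep hq.head hq.last level_s (by rw [ht, hql]) hxy
    rcases hE.flowAdj_or_level_le hM ht htight (hq.adj hxy) with h | h
    · exact h
    · omega
  -- The index of an extra node of `S` that is off the flow. For an `S` whose extra nodes do not
  -- occur after the augmentation, the value `0` is a dummy.
  have hf : ∀ S, ∃ j, IsSourceComponent G S → 2 ≤ (S ∩ unmatched (augmentEdges M E)).ncard →
      j + 1 < (S ∩ unmatched M).ncard ∧ ∀ x, ¬ E x (.extra S j) := by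
    intro S
    by_cases h : IsSourceComponent G S ∧ 2 ≤ (S ∩ unmatched (augmentEdges M E)).ncard
    · obtain ⟨j, hj⟩ := hE.exists_extra_not_into h.1 h.2
      exact ⟨j, fun _ _ => hj⟩
    · exact ⟨0, fun h1 h2 => absurd ⟨h1, h2⟩ h⟩
  choose f hf using hf
  have hextra : ∀ S j, .extra S j ∈ q →
      f S + 1 < (S ∩ unmatched M).ncard ∧ ∀ x, ¬ E x (.extra S (f S)) := by
    intro S j hSj
    obtain ⟨x, hx⟩ := hq.exists_pred hSj nofun
    obtain ⟨a, -, hS, -, hj⟩ := flowAdj_to_extra (hq.adj hx)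
    exact hf S hS (by omega)
  have hchain : (q.map (reindexExtra f)).IsChain (flowGraph G F M).Adj := by
    rw [List.isChain_map, isChain_iff_pair_infix]
    intro x y hxy
    refine flowAdj_reindexExtra (hold x y hxy) ?_
    rintro S j (rfl | rfl)
    · exact (hextra S j (mem_left_of_pair_infix hxy)).1
    · exact (hextra S j (mem_right_of_pair_infix hxy)).1
  have hhead : (q.map (reindexExtra f)).head? = some .s := by
    rw [List.head?_map, hq.head]; rfl
  have hlast : (q.map (reindexExtra f)).getLast? = some .t := by
    rw [List.getLast?_map, hq.last]; rfl
  -- Reindexing is not injective; the nodes remain distinct because the level of each one is its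
  -- position.
  have hpath : IsPath (flowGraph G F M) .s .t (q.map (reindexExtra f)) :=
    ⟨hhead, hlast, hchain, nodup_of_potential
      (fun x y h => level_le_add_one (isChain_iff_pair_infix.1 hchain x y h)) hhead hlast level_s
      (by rw [ht, List.length_map, hql])⟩
  have hshort : IsShortestPath (flowGraph G F M) .s .t (q.map (reindexExtra f)) :=
    ⟨hpath, fun r hr => by rw [List.length_map, hql, ← hD]; exact hp.2 r hr⟩
  have havoid : ∀ y ∈ q.map (reindexExtra f), y ≠ .t → ∀ w, ¬ E w y := by
    intro y hy hyt w
    obtain ⟨z, hz, rfl⟩ := List.mem_map.1 hy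
    have key := hE.not_into_of_isPath hM hq hold hz
    rcases z with x | _ | _ | X | ⟨S, j⟩
    · exact key nofun nofun w
    · exact key nofun nofun w
    · exact absurd rfl hyt
    · exact key nofun nofun w
    · exact (hextra S j hz).2 w
  have hmem : ∀ r ∈ P, ∀ x ∈ r, x ∈ q.map (reindexExtra f) →
      x = FlowVertex.s ∨ x = FlowVertex.t := by
    intro r hr x hxr hxq
    by_contra! hx
    obtain ⟨w, hw⟩ := (hP.shortest r hr).1.exists_pred hxr hx.1
    exact havoid x hxq hx.2 w ⟨r, hr, hw⟩
  refine hP.maximal (q.map (reindexExtra f)) ?_ hshort ?_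
  · intro hqP
    obtain ⟨y, hy⟩ := hpath.exists_succ hpath.head_mem nofun
    rcases hmem _ hqP y (mem_right_of_pair_infix hy) (mem_right_of_pair_infix hy) with rfl | rfl
    · exact ne_of_pair_infix hpath.nodup hy rfl
    · have : FlowAdj G F M .s .t := hpath.adj hy
      cases this
  · rintro r (rfl | hr) r' (rfl | hr') hrr x hx hx'
    · exact absurd rfl hrr
    · exact hmem r' hr' x hx' hx
    · exact hmem r hr x hx hx'
    · exact hP.disjoint r hr r' hr' hrr x hx hx'

end Distance

/-! ### A cut bounds the possible improvement of a matching -/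

/-- A form of weak duality for bipartite matchings: `N` and `N'` are matchings between `L` and `W`,
and `C` separates a part `A ∪ B` of the vertices, closed under alternating walks with respect
to `N`, from the rest. -/
theorem ncard_le_of_bipartite_cut {L W : Type*} [Finite L] [Finite W] {N N' : Set (L × W)}
    (hN : ∀ e ∈ N, ∀ f ∈ N, e.1 = f.1 → e = f)
    (hN₁ : ∀ e ∈ N', ∀ f ∈ N', e.1 = f.1 → e = f)
    (hN₂ : ∀ e ∈ N', ∀ f ∈ N', e.2 = f.2 → e = f)
    {A : Set L} {B : Set W} {C : Set (L ⊕ W)}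
    (h₁ : ∀ e ∈ N', e.1 ∉ A → (∀ w, (e.1, w) ∉ N) → .inl e.1 ∈ C)
    (h₂ : ∀ e ∈ N', e.1 ∈ A → e ∉ N → e.2 ∈ B ∨ .inr e.2 ∈ C)
    (h₃ : ∀ w ∈ B, ∃ x, (x, w) ∈ N ∧ (x ∈ A ∨ .inl x ∈ C)) :
    N'.ncard ≤ N.ncard + C.ncard := by
  classical
  have hcard := Finset.card_le_card_of_forall_subsingleton
    (s := (Set.toFinite N').toFinset)
    (t := (Set.toFinite N).toFinset.disjSum (Set.toFinite C).toFinset)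
    -- Each edge `e` of `N'` is charged to an edge of `N` or a node of `C`. If `e.1 ∉ A`, it is
    -- charged to the `N`-edge at `e.1`, or to `e.1` itself if there is none. If `e.1 ∈ A`, it is
    -- charged to the `N`-edge at `e.2` when that starts in `A`, otherwise to the start of that edge
    -- or to `e.2`, in `C`. The side conditions keep the two kinds of charges apart, so none is
    -- shared.
    (fun e y => match y with
      | .inl f => (e.1 ∉ A ∧ f.1 = e.1) ∨ (e.1 ∈ A ∧ f.1 ∈ A ∧ f.2 = e.2)
      | .inr (.inl c) => (e.1 ∉ A ∧ e.1 = c ∧ ∀ w, (c, w) ∉ N) ∨ (e.1 ∈ A ∧ (c, e.2) ∈ N)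
      | .inr (.inr d) => e.2 = d) ?_ ?_
  · rwa [Finset.card_disjSum, ← Set.ncard_eq_toFinset_card, ← Set.ncard_eq_toFinset_card,
      ← Set.ncard_eq_toFinset_card] at hcard
  · intro e he
    simp only [Set.Finite.mem_toFinset] at he
    by_cases hA : e.1 ∈ A
    · by_cases heN : e ∈ N
      · exact ⟨.inl e, by simpa using heN, .inr ⟨hA, hA, rfl⟩⟩
      · rcases h₂ e he hA heN with hB | hC
        · obtain ⟨x, hx, hxA | hxC⟩ := h₃ _ hB
          · exact ⟨.inl (x, e.2), by simpa using hx, .inr ⟨hA, hxA, rfl⟩⟩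
          · exact ⟨.inr (.inl x), by simpa using hxC, .inr ⟨hA, hx⟩⟩
        · exact ⟨.inr (.inr e.2), by simpa using hC, rfl⟩
    · by_cases heN : ∃ w, (e.1, w) ∈ N
      · obtain ⟨w, hw⟩ := heN
        exact ⟨.inl (e.1, w), by simpa using hw, .inl ⟨hA, rfl⟩⟩
      · have heN : ∀ w, (e.1, w) ∉ N := fun w hw => heN ⟨w, hw⟩
        exact ⟨.inr (.inl e.1), by simpa using h₁ e he hA heN, .inl ⟨hA, rfl, heN⟩⟩
  · rintro y hy e ⟨he, hey⟩ f ⟨hf, hfy⟩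
    simp only [Set.Finite.mem_toFinset] at he hf
    rcases y with g | c | d
    · rcases hey with ⟨h1, h2⟩ | ⟨h1, h2, h3⟩ <;> rcases hfy with ⟨h4, h5⟩ | ⟨h4, h5, h6⟩
      · exact hN₁ e he f hf (h2.symm.trans h5)
      · exact absurd (h2 ▸ h5) h1
      · exact absurd (h5 ▸ h2) h4
      · exact hN₂ e he f hf (h3.symm.trans h6)
    · rcases hey with ⟨h1, h2, h3⟩ | ⟨h1, h2⟩ <;> rcases hfy with ⟨h4, h5, h6⟩ | ⟨h4, h5⟩
      · exact hN₁ e he f hf (h2.trans h5.symm)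
      · exact absurd h5 (h3 _)
      · exact absurd h2 (h6 _)
      · have h7 := congrArg Prod.snd (hN _ h2 _ h5 rfl)
        exact hN₂ e he f hf h7
    · exact hN₂ e he f hf (hey.trans hfy.symm)

section Cut

variable {V : Type*} {G : Digraph V} {F : Set V} {M : Set (V × V)}

/-- The matching `M`, in which moreover every source component with an unmatched vertex is matched
to one of its unmatched vertices. -/
def extendedMatching (G : Digraph V) (M : Set (V × V)) : Set ((V ⊕ Set V) × V) :=
  {e | (∃ u, e.1 = .inl u ∧ (u, e.2) ∈ M) ∨
    ∃ S, e.1 = .inr S ∧ IsSourceComponent G S ∧ ∃ h : (S ∩ unmatched M).Nonempty, e.2 = h.some}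

theorem inl_mem_extendedMatching {u v : V} :
    (.inl u, v) ∈ extendedMatching G M ↔ (u, v) ∈ M := by
  simp [extendedMatching]

theorem inr_mem_extendedMatching {S : Set V} {v : V} :
    (.inr S, v) ∈ extendedMatching G M ↔
      IsSourceComponent G S ∧ ∃ h : (S ∩ unmatched M).Nonempty, v = h.some := by
  simp [extendedMatching]

theorem mem_inter_of_inr_mem_extendedMatching {S : Set V} {v : V}
    (h : (.inr S, v) ∈ extendedMatching G M) : v ∈ S ∩ unmatched M := by
  obtain ⟨-, hne, rfl⟩ := inr_mem_extendedMatching.1 h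
  exact hne.some_mem

theorem IsMatching.extendedMatching_source_inj (hM : IsMatching G M) :
    ∀ e ∈ extendedMatching G M, ∀ f ∈ extendedMatching G M, e.1 = f.1 → e = f := by
  rintro ⟨u | S, v⟩ he ⟨x, v'⟩ hf (rfl : _ = x)
  · rw [inl_mem_extendedMatching] at he hf
    obtain rfl : v = v' := congrArg Prod.snd (hM.source_inj _ he _ hf rfl)
    rfl
  · obtain ⟨-, h, rfl⟩ := inr_mem_extendedMatching.1 he
    obtain ⟨-, -, rfl⟩ := inr_mem_extendedMatching.1 hf
    rfl

theorem IsMatching.extendedMatching_dest_inj (hM : IsMatching G M) :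
    ∀ e ∈ extendedMatching G M, ∀ f ∈ extendedMatching G M, e.2 = f.2 → e = f := by
  rintro ⟨u | S, v⟩ he ⟨u' | S', v'⟩ hf (rfl : v = v')
  · rw [inl_mem_extendedMatching] at he hf
    obtain rfl : u = u' := congrArg Prod.fst (hM.dest_inj _ he _ hf rfl)
    rfl
  · rw [inl_mem_extendedMatching] at he
    exact absurd (mem_inter_of_inr_mem_extendedMatching hf).2 (notMem_unmatched_of_mem he)
  · rw [inl_mem_extendedMatching] at hf
    exact absurd (mem_inter_of_inr_mem_extendedMatching he).2 (notMem_unmatched_of_mem hf)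
  · rw [(inr_mem_extendedMatching.1 he).1.eq_of_mem (inr_mem_extendedMatching.1 hf).1
      (mem_inter_of_inr_mem_extendedMatching he).1 (mem_inter_of_inr_mem_extendedMatching hf).1]

theorem IsMatching.ncard_extendedMatching [Finite V] (hM : IsMatching G M) :
    (extendedMatching G M).ncard = M.ncard +
      {S : Set V | IsSourceComponent G S ∧ (S ∩ unmatched M).Nonempty}.ncard := by
  have h : Prod.fst '' extendedMatching G M = Sum.inl '' {u | ∃ v, (u, v) ∈ M} ∪
      Sum.inr '' {S : Set V | IsSourceComponent G S ∧ (S ∩ unmatched M).Nonempty} := by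
    ext x
    rcases x with u | S
    · simp [inl_mem_extendedMatching]
    · simp [inr_mem_extendedMatching]
  rw [← Set.InjOn.ncard_image fun e he f hf h => hM.extendedMatching_source_inj e he f hf h, h,
    Set.ncard_union_eq (by simp [Set.disjoint_left]) (Set.toFinite _) (Set.toFinite _),
    Set.ncard_image_of_injective _ Sum.inl_injective,
    Set.ncard_image_of_injective _ Sum.inr_injective, hM.ncard_sources]

/-- The nodes of the flow graph other than the terminals and the extra nodes. -/
def cutNode : (V ⊕ Set V) ⊕ V → FlowVertex V
  | .inl (.inl u) => .src u
  | .inl (.inr S) => .comp S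
  | .inr v => .dst v

theorem cutNode_injective : Function.Injective (cutNode : (V ⊕ Set V) ⊕ V → FlowVertex V) := by
  rintro ((u | S) | v) ((u' | S') | v') h <;> simp_all [cutNode]

/-- If all edges that leave a set `R` of nodes containing `s` but not `t` lead to `C`, then no
allowed matching improves on the cost of `M` by more than the cardinality of `C`. -/
theorem cost_le_of_cut [Finite V] {M' : Set (V × V)} (hM : IsMatching G M)
    (hM' : IsAllowedMatching G F M') {R : Set (FlowVertex V)} {C : Set ((V ⊕ Set V) ⊕ V)}
    (hs : .s ∈ R) (ht : .t ∉ R)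
    (hR : ∀ x ∈ R, ∀ y, FlowAdj G F M x y → y ∈ R ∨ ∃ c ∈ C, cutNode c = y) :
    cost G M ≤ cost G M' + C.ncard := by
  have key := ncard_le_of_bipartite_cut hM.extendedMatching_source_inj
    hM'.1.extendedMatching_source_inj hM'.1.extendedMatching_dest_inj
    -- A component counts as reached through the node from which the flow graph offers its other
    -- choices: `comp S` if it has no unmatched vertex, the sole unmatched vertex otherwise. With
    -- two or more unmatched vertices it is never in `A`.
    (A := {x | match x with
      | .inl u => .src u ∈ R
      | .inr S => (S ∩ unmatched M = ∅ ∧ .comp S ∈ R) ∨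
          ∃ a, S ∩ unmatched M = {a} ∧ .dst a ∈ R})
    (B := {v | .dst v ∈ R}) (C := C) ?_ ?_ ?_
  · rw [hM.ncard_extendedMatching, hM'.1.ncard_extendedMatching] at key
    have h1 := hM.cost_add
    have h2 := hM'.1.cost_add
    omega
  · rintro ⟨u | S, v⟩ he hA hN
    · have hN : ∀ w, (u, w) ∉ M := fun w hw => hN w (inl_mem_extendedMatching.2 hw)
      rcases hR _ hs _ (.source u hN) with h | ⟨c, hc, h⟩
      · exact absurd h hA
      · rwa [← cutNode_injective (a₁ := c) (a₂ := .inl (.inl u)) h]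
    · have hS := (inr_mem_extendedMatching.1 he).1
      have hSU : S ∩ unmatched M = ∅ := by
        by_contra hne
        exact hN _ (inr_mem_extendedMatching.2 ⟨hS, Set.nonempty_iff_ne_empty.2 hne, rfl⟩)
      rcases hR _ hs _ (.toComp S hS hSU) with h | ⟨c, hc, h⟩
      · exact absurd (Or.inl ⟨hSU, h⟩) hA
      · rwa [← cutNode_injective (a₁ := c) (a₂ := .inl (.inr S)) h]
  · have hdst : ∀ {v x}, x ∈ R → FlowAdj G F M x (.dst v) → .dst v ∈ R ∨ .inr v ∈ C := by
      intro v x hx hadj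
      rcases hR _ hx _ hadj with h | ⟨c, hc, h⟩
      · exact .inl h
      · right
        rwa [← cutNode_injective (a₁ := c) (a₂ := .inr v) h]
    rintro ⟨u | S, v⟩ he hA hN
    · exact hdst hA (.split _ _ (.forward u v (hM'.1.adj _ (inl_mem_extendedMatching.1 he))
        fun h => hN (inl_mem_extendedMatching.2 h)))
    · have hS := (inr_mem_extendedMatching.1 he).1
      have hv := mem_inter_of_inr_mem_extendedMatching he
      have hvF : v ∉ F := by
        intro hvF
        have : v ∈ unmatched M' ∩ F := ⟨hv.2, hvF⟩
        rw [hM'.2] at this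
        exact this
      rcases hA with ⟨h1, h2⟩ | ⟨a, h1, h2⟩
      · exact hdst h2 (.fromComp S v hS h1 hv.1 hvF)
      · exact hdst h2 (.split _ _ (.shift S a v hS h1 hv.1 hvF))
  · intro v (hv : .dst v ∈ R)
    by_cases hvU : v ∈ unmatched M
    · by_cases hvS : ∃ S, IsSourceComponent G S ∧ v ∈ S
      · obtain ⟨S, hS, hvS⟩ := hvS
        have hne : (S ∩ unmatched M).Nonempty := ⟨v, hvS, hvU⟩
        -- With two unmatched vertices there would be a route through an extra node to `t`. `C`
        -- contains neither kind of node, so `t` would lie in `R`.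
        have hcard : (S ∩ unmatched M).ncard ≤ 1 := by
          by_contra hk
          rcases hR _ hv _ (.toExtra S v 0 hS ⟨hvS, hvU⟩ (by omega)) with h | ⟨c, -, h⟩
          · rcases hR _ h _ (.fromExtra S 0 hS (by omega)) with h | ⟨c, -, h⟩
            · exact ht h
            · rcases c with (_ | _) | _ <;> cases h
          · rcases c with (_ | _) | _ <;> cases h
        rw [Set.ncard_le_one (Set.toFinite _)] at hcard
        refine ⟨.inr S, inr_mem_extendedMatching.2 ⟨hS, hne, ?_⟩, .inl (.inr ⟨v, ?_, hv⟩)⟩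
        · exact hcard _ ⟨hvS, hvU⟩ _ hne.some_mem
        · exact Set.eq_singleton_iff_unique_mem.2
            ⟨⟨hvS, hvU⟩, fun w hw => hcard _ hw _ ⟨hvS, hvU⟩⟩
      · rcases hR _ hv _ (.sink v hvU fun S hS h => hvS ⟨S, hS, h⟩) with h | ⟨c, -, h⟩
        · exact absurd h ht
        · rcases c with (_ | _) | _ <;> cases h
    · obtain ⟨u, hu⟩ := exists_mem_of_notMem_unmatched hvU
      refine ⟨.inl u, inl_mem_extendedMatching.2 hu, ?_⟩
      rcases hR _ hv _ (.split _ _ (.backward u v (hM.adj _ hu) hu)) with h | ⟨c, hc, h⟩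
      · exact .inl h
      · right
        rwa [← cutNode_injective (a₁ := c) (a₂ := .inl (.inl u)) h]

theorem Terminates.isMinCostAllowedMatching [Finite V] (hT : Terminates G F M)
    (hM : IsAllowedMatching G F M) : IsMinCostAllowedMatching G F M := by
  refine ⟨hM, fun M' hM' => ?_⟩
  have := cost_le_of_cut hM.1 hM' (R := {x | ∃ p, IsPath (flowGraph G F M) .s x p}) (C := ∅)
    ⟨_, isPath_singleton _ _⟩ hT (by
      rintro x ⟨p, hp⟩ y hxy
      obtain ⟨q, hq, -⟩ := hp.exists_extend (c := y) hxy
      exact .inl ⟨q, hq⟩)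
  simpa using this

/-- Each level `1, …, D` is a cut and so has at least as many nodes as the possible improvement. The
levels are disjoint, and their nodes are sources, destinations and source components: at most `n` of
each. A list of `D + 3` nodes is a path of length `D + 2`. -/
theorem mul_cost_sub_le [Finite V] [Nonempty V] {M' : Set (V × V)} {D : ℕ}
    (hM : IsMatching G M) (hM' : IsAllowedMatching G F M')
    (hD : ∀ p, IsPath (flowGraph G F M) .s .t p → D + 3 ≤ p.length) :
    D * (cost G M - cost G M') ≤ 3 * Nat.card V := by
  classical
  have := Fintype.ofFinite V
  have ht : level G F M (D + 2) .t = D + 2 := level_t hD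
  let φ : (V ⊕ Set V) ⊕ V → ℕ := fun c => level G F M (D + 2) (cutNode c)
  have hcut : ∀ i ∈ Finset.Icc 1 D, cost G M - cost G M' ≤ {c | φ c = i}.ncard := by
    intro i hi
    rw [Finset.mem_Icc] at hi
    rw [Nat.sub_le_iff_le_add']
    refine cost_le_of_cut hM hM' (R := {x | level G F M (D + 2) x < i}) ?_ ?_ ?_
    · change level G F M (D + 2) .s < i
      rw [level_s]
      omega
    · change ¬ level G F M (D + 2) .t < i
      rw [ht]
      omega
    · intro x (hx : level G F M (D + 2) x < i) y hxy
      have h1 := level_le_add_one (D := D + 2) hxy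
      by_cases hy : level G F M (D + 2) y < i
      · exact .inl hy
      right
      have hyi : level G F M (D + 2) y = i := by omega
      rcases y with (u | v) | _ | _ | S | ⟨S, j⟩
      · exact ⟨.inl (.inl u), hyi, rfl⟩
      · exact ⟨.inr v, hyi, rfl⟩
      · exact absurd hxy not_flowAdj_to_s
      · omega
      · exact ⟨.inl (.inr S), hyi, rfl⟩
      -- A used extra node is adjacent to `t`, so its level is at least `D + 1` and it lies on none
      -- of these cuts.
      · obtain ⟨a, -, hS, -, hj⟩ := flowAdj_to_extra hxy
        have := level_le_add_one (D := D + 2) (FlowAdj.fromExtra (F := F) S j hS hj)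
        omega
  have hsub : {c | φ c ∈ Set.Icc 1 D} ⊆
      (Sum.inl '' (Sum.inl '' Set.univ ∪ Sum.inr '' {S : Set V | IsSourceComponent G S})) ∪
        Sum.inr '' (Set.univ : Set V) := by
    rintro ((u | S) | v) hc
    · simp
    · have hlt : level G F M (D + 2) (.comp S) < levelCap G (D + 2) (.comp S) := by
        have : level G F M (D + 2) (.comp S) ≤ D := hc.2
        simp only [levelCap]
        omega
      obtain ⟨y, hy⟩ := exists_flowAdj_of_level_lt (x := .comp S) nofun hlt
      simpa using (flowAdj_to_comp hy).2.1
    · simp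
  have hle : {c | φ c ∈ Set.Icc 1 D}.ncard ≤ 3 * Nat.card V := by
    refine (Set.ncard_le_ncard hsub (Set.toFinite _)).trans ?_
    refine (Set.ncard_union_le _ _).trans ?_
    rw [Set.ncard_image_of_injective _ Sum.inl_injective,
      Set.ncard_image_of_injective _ Sum.inr_injective, Set.ncard_univ]
    have h1 := Set.ncard_union_le (Sum.inl '' (Set.univ : Set V))
      (Sum.inr '' {S : Set V | IsSourceComponent G S})
    rw [Set.ncard_image_of_injective _ Sum.inl_injective,
      Set.ncard_image_of_injective _ Sum.inr_injective, Set.ncard_univ] at h1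
    have h2 := ncard_setOf_isSourceComponent_le (G := G)
    omega
  refine le_trans ?_ hle
  have hsum := Finset.card_eq_sum_card_fiberwise (f := φ)
    (s := (Set.toFinite {c | φ c ∈ Set.Icc 1 D}).toFinset) (t := Finset.Icc 1 D)
    (fun c hc => by simpa using hc)
  rw [Set.ncard_eq_toFinset_card _ (Set.toFinite _), hsum]
  have hconst := Finset.card_nsmul_le_sum (Finset.Icc 1 D)
    (fun i => {c ∈ (Set.toFinite {c | φ c ∈ Set.Icc 1 D}).toFinset | φ c = i}.card)
    (cost G M - cost G M') (fun i hi => by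
      refine (hcut i hi).trans ?_
      rw [Set.ncard_eq_toFinset_card _ (Set.toFinite _)]
      refine Finset.card_le_card fun c hc => ?_
      rw [Set.Finite.mem_toFinset] at hc
      rw [Finset.mem_filter, Set.Finite.mem_toFinset]
      rw [Finset.mem_Icc] at hi
      have hc' : φ c = i := hc
      exact ⟨by rw [Set.mem_ofPred_eq, hc']; exact hi, hc'⟩)
  simpa using hconst

end Cut

/-! ### Executions of the algorithm -/

section Runs

variable {V : Type*} {G : Digraph V} {F : Set V} {M : Set (V × V)}

theorem exists_iteration_of_not_terminates [Finite V] (h : ¬ Terminates G F M) :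
    ∃ M', Iteration G F M M' := by
  obtain ⟨p, hp⟩ := not_not.1 h
  -- `FlowVertex V` is infinite because of the indices of the extra nodes, but those on a path are
  -- below the number of vertices.
  let T : Set (FlowVertex V) := Set.range FlowVertex.src ∪ Set.range FlowVertex.dst ∪
    {.s, .t} ∪ Set.range FlowVertex.comp ∪
    (fun x : Set V × ℕ => FlowVertex.extra x.1 x.2) '' (Set.univ ×ˢ Set.Iio (Nat.card V))
  have hT : T.Finite := by
    refine Set.Finite.union (Set.Finite.union (Set.Finite.union (Set.Finite.union ?_ ?_) ?_) ?_) ?_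
    · exact Set.finite_range _
    · exact Set.finite_range _
    · exact Set.toFinite _
    · exact Set.finite_range _
    · exact (Set.finite_univ.prod (Set.finite_Iio _)).image _
  have hfin : {p | IsShortestPath (flowGraph G F M) .s .t p}.Finite := by
    refine finite_setOf_isShortestPath hT fun q hq x hx => ?_
    rcases x with (u | v) | _ | _ | S | ⟨S, j⟩
    · simp [T]
    · simp [T]
    · simp [T]
    · simp [T]
    · simp [T]
    · obtain ⟨y, hy⟩ := hq.exists_pred hx nofun
      obtain ⟨a, -, -, -, hj⟩ := flowAdj_to_extra (hq.adj hy)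
      refine .inr ⟨(S, j), ⟨trivial, ?_⟩, rfl⟩
      have := Set.ncard_le_card (S ∩ unmatched M)
      simp only [Set.mem_Iio]
      omega
  obtain ⟨P, h1, h2, h3⟩ := exists_isMaximalDisjointShortestPaths hfin hp
  exact ⟨_, P, h1, h2, h3, rfl⟩

theorem three_le_length_of_isPath {p : List (FlowVertex V)}
    (hp : IsPath (flowGraph G F M) .s .t p) : 3 ≤ p.length := by
  obtain ⟨y, hy⟩ := hp.exists_succ hp.head_mem nofun
  have hyt : y ≠ .t := by
    rintro rfl
    have : FlowAdj G F M .s .t := hp.adj hy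
    cases this
  obtain ⟨z, hz⟩ := hp.exists_succ (mem_right_of_pair_infix hy) hyt
  obtain ⟨i, h1, h2⟩ := pair_infix_iff.1 hy
  obtain ⟨j, h3, h4⟩ := pair_infix_iff.1 hz
  obtain rfl := getElem?_inj_of_nodup hp.nodup h2 h3
  have := (List.getElem?_eq_some_iff.1 h4).1
  omega

theorem Iteration.spec [Finite V] {M' : Set (V × V)} (h : Iteration G F M M')
    (hM : IsAllowedMatching G F M) :
    IsAllowedMatching G F M' ∧ cost G M' < cost G M ∧
      ∃ p, IsPath (flowGraph G F M) .s .t p ∧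
        ∀ q, IsPath (flowGraph G F M') .s .t q → p.length < q.length := by
  obtain ⟨P, hne, -, hP, rfl⟩ := h
  obtain ⟨p, hp⟩ := List.exists_mem_of_ne_nil P hne
  have hpath : ∀ p ∈ P, IsPath (flowGraph G F M) .s .t p := fun p hp => (hP.shortest p hp).1
  have hE := isUnitFlow_pathEdges hpath hP.disjoint
  have heq : P.foldl augment M = augmentEdges M (pathEdges P) := by
    refine foldl_augment_eq (M' := M) M (fun p hp u v h => ?_) (fun p hp u v h => ?_)
    · rcases flowAdj_to_src ((hpath p hp).adj h) with ⟨h, -⟩ | ⟨w, hw, h⟩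
      · cases h
      · obtain rfl : v = w := by simpa using hw
        exact h
    · obtain ⟨w, hw, -, h⟩ := flowAdj_from_src ((hpath p hp).adj h)
      obtain rfl : v = w := by simpa using hw
      exact h
  rw [heq]
  obtain ⟨x, hx⟩ := (hpath p hp).exists_succ (hpath p hp).head_mem nofun
  exact ⟨hE.isAllowedMatching hM, hE.cost_lt hM.1 ⟨p, hp, hx⟩, p, hpath p hp,
    fun q hq => lt_length_of_isPath_augmentEdges hM.1 hP (hP.shortest p hp) hq⟩

theorem exists_terminating_run [Finite V] (hM : IsAllowedMatching G F M) :
    ∃ (K : ℕ) (N : ℕ → Set (V × V)), IsRun G F M K N ∧ Terminates G F (N K) := by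
  induction hc : cost G M using Nat.strong_induction_on generalizing M with
  | _ c ih =>
    by_cases hT : Terminates G F M
    · exact ⟨0, fun _ => M, ⟨rfl, by simp⟩, hT⟩
    · obtain ⟨M', hM'⟩ := exists_iteration_of_not_terminates hT
      obtain ⟨h1, h2, -⟩ := hM'.spec hM
      obtain ⟨K, N, ⟨h0, hN⟩, hK⟩ := ih _ (hc ▸ h2) h1 rfl
      refine ⟨K + 1, fun i => Nat.casesOn i M N, ⟨rfl, ?_⟩, hK⟩
      rintro (_ | i) hi
      · change Iteration G F M (N 0)
        rwa [h0]
      · exact hN i (by omega)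

variable {K : ℕ} {N : ℕ → Set (V × V)}

theorem IsRun.isAllowedMatching [Finite V] (hN : IsRun G F M K N)
    (hM : IsAllowedMatching G F M) {i : ℕ} (hi : i ≤ K) : IsAllowedMatching G F (N i) := by
  induction i with
  | zero => rwa [hN.1]
  | succ i ih => exact ((hN.2 i hi).spec (ih (by omega))).1

theorem IsRun.cost_add_le [Finite V] (hN : IsRun G F M K N) (hM : IsAllowedMatching G F M)
    {i k : ℕ} (hi : i + k ≤ K) : cost G (N (i + k)) + k ≤ cost G (N i) := by
  induction k with
  | zero => simp
  | succ k ih =>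
    have := ih (by omega)
    have := ((hN.2 (i + k) (by omega)).spec (hN.isAllowedMatching hM (by omega))).2.1
    change cost G (N (i + k + 1)) + (k + 1) ≤ _
    omega

theorem IsRun.add_three_le_length [Finite V] (hN : IsRun G F M K N)
    (hM : IsAllowedMatching G F M) {i : ℕ} (hi : i ≤ K) {q : List (FlowVertex V)}
    (hq : IsPath (flowGraph G F (N i)) .s .t q) : i + 3 ≤ q.length := by
  induction i generalizing q with
  | zero => simpa using three_le_length_of_isPath hq
  | succ i ih =>
    obtain ⟨-, -, p, hp, h⟩ := (hN.2 i hi).spec (hN.isAllowedMatching hM (by omega))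
    have := ih (by omega) hp
    have := h q hq
    omega

/-- After `i` augmentations the distance is at least `i + 2`, and the remaining `K - i` each lower
the cost, so the last matching beats the `i`-th by at least `K - i`. -/
theorem IsRun.mul_sub_le [Finite V] [Nonempty V] (hN : IsRun G F M K N)
    (hM : IsAllowedMatching G F M) {i : ℕ} (hi : i ≤ K) : i * (K - i) ≤ 3 * Nat.card V := by
  have h1 := mul_cost_sub_le (hN.isAllowedMatching hM hi).1 (hN.isAllowedMatching hM le_rfl)
    (fun q hq => hN.add_three_le_length hM hi hq)
  refine le_trans (Nat.mul_le_mul_left i ?_) h1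
  have := hN.cost_add_le hM (i := i) (k := K - i) (by omega)
  rw [Nat.add_sub_cancel' hi] at this
  omega

theorem IsRun.length_le [Fintype V] [Nonempty V] (hN : IsRun G F M K N)
    (hM : IsAllowedMatching G F M) : (K : ℝ) + 1 ≤ 6 * Real.sqrt (Fintype.card V) := by
  have hn : 1 ≤ Fintype.card V := Fintype.card_pos
  have h := hN.mul_sub_le hM (Nat.div_le_self K 2)
  rw [Nat.card_eq_fintype_card] at h
  -- The split at `i = K / 2` gives `m² ≤ 3n` or `m (m + 1) ≤ 3n`. The lower-order terms of `(K +
  -- 1)²` are absorbed using `m ≤ m²` and `1 ≤ n`.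
  have hsq : (K + 1) ^ 2 ≤ 36 * Fintype.card V := by
    obtain ⟨m, rfl | rfl⟩ : ∃ m, K = 2 * m ∨ K = 2 * m + 1 := ⟨K / 2, by omega⟩
    · rw [show 2 * m / 2 = m by omega, show 2 * m - m = m by omega] at h
      nlinarith [Nat.le_mul_self m]
    · rw [show (2 * m + 1) / 2 = m by omega, show 2 * m + 1 - m = m + 1 by omega] at h
      nlinarith
  have hsq' : ((K : ℝ) + 1) ^ 2 ≤ 36 * (Fintype.card V : ℝ) := by exact_mod_cast hsq
  have := Real.le_sqrt_of_sq_le (x := ((K : ℝ) + 1) / 6) (y := Fintype.card V) (by linarith)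
  linarith

end Runs

end MinCostMatching

/-- Let `G` be a directed graph with `n ≥ 1` vertices, `F` a set of forbidden vertices and `M₀` an
allowed matching. Whatever maximal collections of shortest paths are chosen, an execution that has
made `K` augmentations (and so performs `K + 1` iterations, counting the current one, which may be
the last one, that finds no path) satisfies `K + 1 ≤ 6 √n`, and its current matching is allowed; it
either stops there or can be continued; and when it stops, the matching has minimum cost among all
allowed matchings. -/
theorem mainTheorem1 {V : Type*} [Fintype V] [Nonempty V] (G : Digraph V) (F : Set V)
    (M₀ : Set (V × V)) (hM₀ : MinCostMatching.IsAllowedMatching G F M₀) :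
    (∃ (K : ℕ) (M : ℕ → Set (V × V)), MinCostMatching.IsRun G F M₀ K M ∧
      MinCostMatching.Terminates G F (M K)) ∧
    ∀ (K : ℕ) (M : ℕ → Set (V × V)), MinCostMatching.IsRun G F M₀ K M →
      ((K : ℝ) + 1 ≤ 6 * Real.sqrt (Fintype.card V)) ∧
      MinCostMatching.IsAllowedMatching G F (M K) ∧
      (MinCostMatching.Terminates G F (M K) ∨
        ∃ M', MinCostMatching.Iteration G F (M K) M') ∧
      (MinCostMatching.Terminates G F (M K) →
        MinCostMatching.IsMinCostAllowedMatching G F (M K)) := by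
  open MinCostMatching in
  exact ⟨exists_terminating_run hM₀, fun K M hM =>
    have hK : IsAllowedMatching G F (M K) := hM.isAllowedMatching hM₀ le_rfl
    ⟨hM.length_le hM₀, hK, or_iff_not_imp_left.2 exists_iteration_of_not_terminates,
      fun hT => hT.isMinCostAllowedMatching hK⟩⟩
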